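/- Let $n\ge 1$ and $0<s<1$. For $t>0$ let $P_t(x)=P(x,t;s)=(2\pi)^{-n}\int_{\mathbb R^n}e^{i x\cdot\xi}e^{-t|\xi|^{2s}}\,d\xi$ be the fundamental solution of the fractional heat equation $\partial_t u+(-\Delta)^s u=0$ in $\mathbb R^n$, where $(-\Delta)^s$ is the Fourier multiplier with symbol $|\xi|^{2s}$. Let $u_0\in L^1(\mathbb R^n)$ be a real function (of any sign) with compact support, let $M=\int u_0(y)\,dy$ and $\mathcal N_{1,i}(u_0)=\int y_i\,u_0(y)\,dy$ for $1\le i\le n$. Let $u$ be the finite-mass weak solution with initial datum $u_0$, that is: $u$ is continuous on $(0,\infty)\times\mathbb R^n$, $u\in L^1((0,T)\times\mathbb R^n)$ for all $T>0$, and $$\int_0^\infty\!\!\int_{\mathbb R^n}u\,\bigl(\partial_t\varphi-(-\Delta)^s\varphi\bigr)\,dx\,dt+\int_{\mathbb R^n}u_0(x)\,\varphi(x,0)\,dx=0\qquad\text{for all }\varphi\in C_c^\infty(\mathbb R^n\times\mathbb R).$$ Then $$t^{1/(2s)}\,\frac{\bigl|u(x,t)-M P_t(x)+\sum_{i=1}^n\mathcal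 N_{1,i}(u_0)\,\partial_iP_t(x)\bigr|}{P_t(x)}\longrightarrow 0\qquad\text{as }t\to\infty,\text{ uniformly in }x\in\mathbb R^n .$$ In other words, $u(x,t)=M P_t(x)-\sum_{i=1}^n\mathcal N_{1,i}(u_0)\,\partial_iP_t(x)+o(t^{-1/(2s)})\,P_t(x)$ as $t\to\infty$, uniformly in $x\in\mathbb R^n$. -/

import Mathlib

noncomputable section

namespace FractionalHeat

open MeasureTheory Set Function
open scoped FourierTransform ContDiff

/-- Euclidean space `ℝⁿ`. -/
abbrev E (n : ℕ) : Type := EuclideanSpace ℝ (Fin n)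

/-- The fundamental solution `P_t(x) = P(x,t;s)` of the fractional heat equation: the inverse
Fourier transform of `ξ ↦ exp (-t |ξ|^(2s))`. Mathlib's transform uses the character
`exp (2πi⟨x,ξ⟩)`, so the frequency variable is rescaled by `2π`. The transform is real valued,
so taking the real part only changes the codomain. -/
def kernel {n : ℕ} (s t : ℝ) (x : E n) : ℝ :=
  (𝓕⁻ (fun ξ : E n => ((Real.exp (-(t * (2 * Real.pi * ‖ξ‖) ^ (2 * s))) : ℝ) : ℂ)) x).re

/-- The fractional Laplacian `(-Δ)^s f`, for real test functions `f`: the Fourier multiplier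
with symbol `|ξ|^(2s)` (again with frequencies rescaled by `2π`). -/
def fracLaplacian {n : ℕ} (s : ℝ) (f : E n → ℝ) (x : E n) : ℝ :=
  (𝓕⁻ (fun ξ : E n => (((2 * Real.pi * ‖ξ‖) ^ (2 * s) : ℝ) : ℂ) *
    𝓕 (fun y : E n => ((f y : ℝ) : ℂ)) ξ) x).re

/-- `u` is the (continuous for `t > 0`, finite-mass) weak solution of the Cauchy problem
`∂ₜu + (-Δ)^s u = 0` in `(0,∞) × ℝⁿ`, `u(0) = u₀`. The values of `u` at times `t ≤ 0` play no
role; the initial datum is encoded in the weak formulation, whose test functions need not vanish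
at `t = 0`. -/
structure IsWeakSolution {n : ℕ} (s : ℝ) (u₀ : E n → ℝ) (u : ℝ → E n → ℝ) : Prop where
  /-- `u` is the continuous representative on `(0,∞) × ℝⁿ`. -/
  continuousOn : ContinuousOn (uncurry u) (Ioi (0 : ℝ) ×ˢ (univ : Set (E n)))
  /-- `u ∈ L¹((0,T) × ℝⁿ)` for every finite `T`. -/
  integrableOn : ∀ T : ℝ, 0 < T →
    IntegrableOn (uncurry u) (Ioo (0 : ℝ) T ×ˢ (univ : Set (E n)))
  /-- The equation and the initial datum, tested against `φ ∈ C_c^∞(ℝ × ℝⁿ)`. -/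
  weak : ∀ φ : ℝ × E n → ℝ, ContDiff ℝ ∞ φ → HasCompactSupport φ →
    (∫ t in Ioi (0 : ℝ), ∫ x : E n,
        u t x * (deriv (fun τ => φ (τ, x)) t - fracLaplacian s (fun y => φ (t, y)) x))
      + ∫ x : E n, u₀ x * φ (0, x) = 0

/-- The mass `M = ∫ u₀`. -/
def mass {n : ℕ} (u₀ : E n → ℝ) : ℝ := ∫ y : E n, u₀ y

/-- The first moments `N_{1,i}(u₀) = ∫ yᵢ u₀(y) dy`. -/
def firstMoment {n : ℕ} (u₀ : E n → ℝ) (i : Fin n) : ℝ := ∫ y : E n, y i * u₀ y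

/-- The partial derivative `∂ᵢ f`. -/
def partialDeriv {n : ℕ} (i : Fin n) (f : E n → ℝ) (x : E n) : ℝ :=
  fderiv ℝ f x (EuclideanSpace.single i 1)

/-- The remainder `u(x,t) - M P_t(x) + ∑ᵢ N_{1,i}(u₀) ∂ᵢP_t(x)`. -/
def remainder {n : ℕ} (s : ℝ) (u₀ : E n → ℝ) (u : ℝ → E n → ℝ) (t : ℝ) (x : E n) : ℝ :=
  u t x - mass u₀ * kernel s t x
    + ∑ i : Fin n, firstMoment u₀ i * partialDeriv i (kernel s t) x

end FractionalHeat

end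

/-!
Subordination writes the profile `P₁` as a mixture of Gaussians `∫ G_τ dη(τ)` over the one-sided
stable law `η` of index `s`, a weak limit of normalized sums of independent Pareto variables. Each
Gaussian has an explicit second-order Taylor remainder; integrating it against `η`, and comparing
with the lower bound `P₁(z) ≳ (1 + |z|)^(-(n + 2s))`, bounds the remainder of `P₁` pointwise by
`C |k|² P₁(z)` for all `|k| ≤ 1`. By scaling, the increment `-y` of `P_t` costs at most
`C |y|² t^(-1/s) P_t`.

Testing the equation against truncated plane waves shows that every Fourier mode of a weak solution
solves a linear ordinary differential equation, so the solution is `P_t * u₀`. Mass and first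
moments cancel the first-order Taylor polynomial of `P_t`, so the remainder is at most
`K t^(-1/s) P_t`, one factor `t^(-1/(2s))` better than required.
-/

noncomputable section

namespace FractionalHeat

open MeasureTheory Set Function Filter Topology Real Module
open scoped FourierTransform ContDiff NNReal

/-! ### The one-sided stable law -/

section StableLaw

variable {s : ℝ}

/-- The function `v ↦ 1 - exp (-v^(-1/s))`. For `U` uniform on `[0,1]`, the Laplace transform of
the Pareto variable `U^(-1/s)` is expressed through its primitive. -/
def stableProfile (s v : ℝ) : ℝ := 1 - exp (-v ^ (-1 / s))

lemma stableProfile_pos {v : ℝ} (hv : 0 < v) : 0 < stableProfile s v := by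
  have : exp (-v ^ (-1 / s)) < 1 := by
    rw [exp_lt_one_iff, neg_lt_zero]
    positivity
  rw [stableProfile]
  linarith

lemma stableProfile_le_one (v : ℝ) : stableProfile s v ≤ 1 :=
  sub_le_self _ (exp_pos _).le

lemma stableProfile_le_rpow (v : ℝ) : stableProfile s v ≤ v ^ (-1 / s) := by
  rw [stableProfile]
  linarith [add_one_le_exp (-v ^ (-1 / s))]

lemma measurable_stableProfile (s : ℝ) : Measurable (stableProfile s) := by
  unfold stableProfile
  fun_prop

lemma integrableOn_stableProfile (hs0 : 0 < s) (hs1 : s < 1) :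
    IntegrableOn (stableProfile s) (Ioi 0) := by
  rw [← Ioc_union_Ioi_eq_Ioi zero_le_one]
  refine IntegrableOn.union ?_ ?_
  · refine Measure.integrableOn_of_bounded (M := 1) (by simp)
      (measurable_stableProfile s).aestronglyMeasurable
      (ae_restrict_of_forall_mem measurableSet_Ioc fun v hv => ?_)
    rw [norm_of_nonneg (stableProfile_pos hv.1).le]
    exact stableProfile_le_one v
  · have hexp : -1 / s < -1 := by rw [div_lt_iff₀ hs0]; linarith
    refine (integrableOn_Ioi_rpow_of_lt hexp zero_lt_one).mono'
      (measurable_stableProfile s).aestronglyMeasurable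
      (ae_restrict_of_forall_mem measurableSet_Ioi fun v hv => ?_)
    rw [norm_of_nonneg (stableProfile_pos (zero_lt_one.trans hv)).le]
    exact stableProfile_le_rpow v

lemma integral_stableProfile_pos (hs0 : 0 < s) (hs1 : s < 1) :
    0 < ∫ v in Ioi 0, stableProfile s v := by
  rw [setIntegral_pos_iff_support_of_nonneg_ae
    (ae_restrict_of_forall_mem measurableSet_Ioi fun v hv => (stableProfile_pos hv).le)
    (integrableOn_stableProfile hs0 hs1)]
  have : support (stableProfile s) ∩ Ioi 0 = Ioi 0 :=
    inter_eq_right.2 fun v hv => (stableProfile_pos hv).ne'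
  simp [this]

lemma integral_exp_neg_mul_rpow_unitInterval {κ : ℝ} (hs0 : 0 < s) (hκ : 0 < κ) :
    ∫ x : unitInterval, exp (-(κ * (x : ℝ) ^ (-1 / s)))
      = 1 - κ ^ s * ∫ v in (0 : ℝ)..κ ^ (-s), stableProfile s v := by
  have hκs : 0 < κ ^ (-s) := by positivity
  have hint : IntervalIntegrable (fun x : ℝ => exp (-(κ * x ^ (-1 / s)))) volume 0 1 := by
    rw [intervalIntegrable_iff_integrableOn_Ioc_of_le zero_le_one]
    refine Measure.integrableOn_of_bounded (M := 1) (by simp)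
      (by fun_prop : Measurable _).aestronglyMeasurable
      (ae_restrict_of_forall_mem measurableSet_Ioc fun x hx => ?_)
    rw [norm_of_nonneg (exp_pos _).le, exp_le_one_iff, neg_nonpos]
    exact mul_nonneg hκ.le (rpow_nonneg hx.1.le _)
  have hprofile : ∀ x ∈ uIcc (0 : ℝ) 1,
      1 - exp (-(κ * x ^ (-1 / s))) = stableProfile s (κ ^ (-s) * x) := by
    intro x hx
    rw [uIcc_of_le zero_le_one] at hx
    rw [stableProfile, mul_rpow hκs.le hx.1, ← rpow_mul hκ.le,
      show -s * (-1 / s) = 1 by field_simp, rpow_one]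
  calc ∫ x : unitInterval, exp (-(κ * (x : ℝ) ^ (-1 / s)))
      = ∫ x in (0 : ℝ)..1, exp (-(κ * x ^ (-1 / s))) := by
        rw [intervalIntegral.integral_of_le zero_le_one, ← integral_Icc_eq_integral_Ioc]
        exact integral_subtype_comap measurableSet_Icc fun x : ℝ => exp (-(κ * x ^ (-1 / s)))
    _ = 1 - ∫ x in (0 : ℝ)..1, (1 - exp (-(κ * x ^ (-1 / s)))) := by
        rw [intervalIntegral.integral_sub (by simp) hint]; simp
    _ = 1 - κ ^ s * ∫ v in (0 : ℝ)..κ ^ (-s), stableProfile s v := by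
        rw [intervalIntegral.integral_congr hprofile,
          intervalIntegral.integral_comp_mul_left _ hκs.ne', mul_zero, mul_one,
          ← rpow_neg hκ.le, neg_neg, smul_eq_mul]

/-- With `β = (N ∫ stableProfile)^(-1/s)`, the sum of `N` independent copies of `β U^(-1/s)`
converges in law to the stable law. -/
def stableScale (s : ℝ) (N : ℕ) : ℝ := (N * ∫ v in Ioi 0, stableProfile s v) ^ (-1 / s)

lemma stableScale_nonneg (hs0 : 0 < s) (hs1 : s < 1) (N : ℕ) : 0 ≤ stableScale s N := by
  have := integral_stableProfile_pos hs0 hs1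
  unfold stableScale
  positivity

lemma tendsto_integral_exp_neg_stableScale_pow (hs0 : 0 < s) (hs1 : s < 1) {lam : ℝ}
    (hlam : 0 < lam) :
    Tendsto (fun N : ℕ => (∫ x : unitInterval,
      exp (-(lam * stableScale s N * (x : ℝ) ^ (-1 / s)))) ^ N) atTop (𝓝 (exp (-lam ^ s))) := by
  set c := ∫ v in Ioi 0, stableProfile s v with hc
  have hcpos : 0 < c := integral_stableProfile_pos hs0 hs1
  have hprimitive : Tendsto (fun N : ℕ => ∫ v in (0 : ℝ)..N * (c / lam ^ s), stableProfile s v)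
      atTop (𝓝 c) :=
    intervalIntegral_tendsto_integral_Ioi 0 (integrableOn_stableProfile hs0 hs1)
      (tendsto_natCast_atTop_atTop.atTop_mul_const (by positivity))
  have hlim := (hprimitive.const_mul (lam ^ s / c)).neg
  rw [div_mul_cancel₀ _ hcpos.ne'] at hlim
  refine (tendsto_one_add_pow_exp_of_tendsto (g := fun N : ℕ =>
    -(lam ^ s / (N * c) * ∫ v in (0 : ℝ)..N * (c / lam ^ s), stableProfile s v))
    (hlim.congr' ?_)).congr' ?_ <;> filter_upwards [eventually_gt_atTop 0] with N hN
  · field_simp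
  · have hNc : 0 < N * c := by positivity
    have hscale : 0 < stableScale s N := rpow_pos_of_pos hNc _
    have hpow : (lam * stableScale s N) ^ s = lam ^ s / (N * c) := by
      rw [mul_rpow hlam.le hscale.le, stableScale, ← hc, ← rpow_mul hNc.le,
        div_mul_cancel₀ _ hs0.ne', rpow_neg_one, div_eq_mul_inv]
    rw [integral_exp_neg_mul_rpow_unitInterval hs0 (mul_pos hlam hscale),
      rpow_neg (mul_pos hlam hscale).le, hpow, inv_div, mul_div_assoc, sub_eq_add_neg]

/-- The map `x ↦ exp (-β x^(-1/s))`; it compactifies the range `[0,∞]` of the Pareto variable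
`β U^(-1/s)` to `[0,1]` and turns sums of such variables into products. -/
def expNegPareto (s : ℝ) (β : ℝ≥0) (x : unitInterval) : unitInterval :=
  ⟨exp (-(β * (x : ℝ) ^ (-1 / s))), (exp_pos _).le, exp_le_one_iff.2
    (neg_nonpos.2 (mul_nonneg β.2 (rpow_nonneg x.2.1 _)))⟩

lemma measurable_expNegPareto (s : ℝ) (β : ℝ≥0) : Measurable (expNegPareto s β) := by
  refine Measurable.subtype_mk ?_
  fun_prop

lemma integral_prod_expNegPareto_rpow (s lam : ℝ) (β : ℝ≥0) (N : ℕ) :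
    ∫ w : Fin N → unitInterval, ((∏ i, expNegPareto s β (w i) : unitInterval) : ℝ) ^ lam
      = (∫ x : unitInterval, exp (-(lam * β * (x : ℝ) ^ (-1 / s)))) ^ N := by
  have hfactor (x : unitInterval) :
      (expNegPareto s β x : ℝ) ^ lam = exp (-(lam * β * (x : ℝ) ^ (-1 / s))) := by
    rw [expNegPareto, ← exp_mul]
    ring_nf
  have hprod := integral_fintype_prod_volume_eq_pow (ι := Fin N)
    fun x : unitInterval => exp (-(lam * β * (x : ℝ) ^ (-1 / s)))
  rw [Fintype.card_fin] at hprod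
  rw [← hprod]
  refine integral_congr_ae (.of_forall fun w => ?_)
  have hcoe : ((∏ i, expNegPareto s β (w i) : unitInterval) : ℝ)
      = ∏ i, (expNegPareto s β (w i) : ℝ) :=
    map_prod unitInterval.submonoid.subtype _ _
  simp only [← hfactor, hcoe]
  exact (finsetProd_rpow _ _ (fun i _ => (expNegPareto s β (w i)).2.1) _).symm

lemma exists_probabilityMeasure_integral_eq_of_tendsto {X : Type*} [TopologicalSpace X]
    [CompactSpace X] [T2Space X] [MeasurableSpace X] [BorelSpace X]
    (ν : ℕ → ProbabilityMeasure X) :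
    ∃ μ : ProbabilityMeasure X, ∀ (f : C(X, ℝ)) (a : ℝ),
      Tendsto (fun N => ∫ x, f x ∂(ν N : Measure X)) atTop (𝓝 a) →
        ∫ x, f x ∂(μ : Measure X) = a := by
  obtain ⟨μ, hμ⟩ := exists_clusterPt_of_compactSpace (map ν atTop)
  refine ⟨μ, fun f a hlim => ?_⟩
  have hcluster : MapClusterPt (∫ x, f x ∂(μ : Measure X)) atTop
      (fun N => ∫ x, f x ∂(ν N : Measure X)) :=
    MapClusterPt.continuousAt_comp
      (ProbabilityMeasure.continuous_integral_continuousMap f).continuousAt hμ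
  exact eq_of_nhds_neBot (NeBot.mono hcluster (inf_le_inf_left _ hlim))

lemma exists_probabilityMeasure_unitInterval_integral_rpow_eq (hs0 : 0 < s) (hs1 : s < 1) :
    ∃ μ : ProbabilityMeasure unitInterval, ∀ lam : ℝ, 0 < lam →
      ∫ z : unitInterval, (z : ℝ) ^ lam ∂(μ : Measure unitInterval) = exp (-lam ^ s) := by
  let β (N : ℕ) : ℝ≥0 := ⟨stableScale s N, stableScale_nonneg hs0 hs1 N⟩
  let Z (N : ℕ) (w : Fin N → unitInterval) : unitInterval := ∏ i, expNegPareto s (β N) (w i)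
  have hZ (N : ℕ) : Measurable (Z N) :=
    Finset.measurable_prod _ fun i _ => (measurable_expNegPareto s _).comp (measurable_pi_apply i)
  obtain ⟨μ, hμ⟩ := exists_probabilityMeasure_integral_eq_of_tendsto fun N =>
    ⟨Measure.map (Z N) volume, Measure.isProbabilityMeasure_map (hZ N).aemeasurable⟩
  refine ⟨μ, fun lam hlam => ?_⟩
  have hcont : Continuous fun z : unitInterval => (z : ℝ) ^ lam :=
    continuous_subtype_val.rpow_const fun _ => Or.inr hlam.le
  refine hμ ⟨_, hcont⟩ _ ((tendsto_integral_exp_neg_stableScale_pow hs0 hs1 hlam).congr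
    fun N => ?_)
  exact (integral_prod_expNegPareto_rpow s lam (β N) N).symm.trans
    (integral_map (hZ N).aemeasurable hcont.aestronglyMeasurable).symm

section UnitInterval

variable (μ : Measure unitInterval) [IsProbabilityMeasure μ] {lam : ℝ}

lemma integrable_unitInterval_rpow (hlam : 0 < lam) :
    Integrable (fun z : unitInterval => (z : ℝ) ^ lam) μ := by
  refine Integrable.of_bound (C := 1)
    (continuous_subtype_val.rpow_const fun _ => Or.inr hlam.le).aestronglyMeasurable
    (.of_forall fun z => ?_)
  rw [norm_of_nonneg (rpow_nonneg z.2.1 _)]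
  exact rpow_le_one z.2.1 z.2.2 hlam.le

lemma measureReal_singleton_one_le_integral_rpow (hlam : 0 < lam) :
    μ.real {1} ≤ ∫ z : unitInterval, (z : ℝ) ^ lam ∂μ := by
  rw [← integral_indicator_one (measurableSet_singleton _)]
  refine integral_mono ((integrable_const (1 : ℝ)).indicator (measurableSet_singleton _))
    (integrable_unitInterval_rpow μ hlam) (indicator_le' ?_ ?_)
  · simp
  · exact fun z _ => rpow_nonneg z.2.1 _

lemma measureReal_singleton_zero_le_one_sub_integral_rpow (hlam : 0 < lam) :
    μ.real {0} ≤ 1 - ∫ z : unitInterval, (z : ℝ) ^ lam ∂μ := by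
  have hint := (integrable_const (1 : ℝ)).sub (integrable_unitInterval_rpow μ hlam)
  have hsub : ∫ z : unitInterval, (1 - (z : ℝ) ^ lam) ∂μ
      = 1 - ∫ z : unitInterval, (z : ℝ) ^ lam ∂μ := by
    rw [integral_sub (integrable_const _) (integrable_unitInterval_rpow μ hlam)]
    simp
  rw [← hsub, ← integral_indicator_one (measurableSet_singleton _)]
  refine integral_mono ((integrable_const (1 : ℝ)).indicator (measurableSet_singleton _)) hint
    (indicator_le' ?_ ?_)
  · simp [zero_rpow hlam.ne']
  · exact fun z _ => sub_nonneg.2 (rpow_le_one z.2.1 z.2.2 hlam.le)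

lemma ae_mem_Ioo_of_integral_rpow_eq (hs0 : 0 < s) (hμ : ∀ lam : ℝ, 0 < lam →
      ∫ z : unitInterval, (z : ℝ) ^ lam ∂μ = exp (-lam ^ s)) :
    ∀ᵐ z : unitInterval ∂μ, (z : ℝ) ∈ Ioo 0 1 := by
  have hzero : μ {0} = 0 := by
    have hlim : Tendsto (fun lam : ℝ => 1 - exp (-lam ^ s)) (𝓝[>] 0) (𝓝 0) := by
      have hcont : ContinuousAt (fun lam : ℝ => 1 - exp (-lam ^ s)) 0 := by
        have := continuousAt_rpow_const 0 s (Or.inr hs0.le)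
        fun_prop
      simpa [ContinuousAt, zero_rpow hs0.ne'] using hcont.tendsto.mono_left nhdsWithin_le_nhds
    refine (measureReal_eq_zero_iff).1 (le_antisymm (ge_of_tendsto hlim ?_) measureReal_nonneg)
    filter_upwards [self_mem_nhdsWithin] with lam hlam
    exact hμ lam hlam ▸ measureReal_singleton_zero_le_one_sub_integral_rpow μ hlam
  have hone : μ {1} = 0 := by
    have hlim : Tendsto (fun lam : ℝ => exp (-lam ^ s)) atTop (𝓝 0) :=
      tendsto_exp_neg_atTop_nhds_zero.comp (tendsto_rpow_atTop hs0)
    refine (measureReal_eq_zero_iff).1 (le_antisymm (ge_of_tendsto hlim ?_) measureReal_nonneg)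
    filter_upwards [eventually_gt_atTop 0] with lam hlam
    exact hμ lam hlam ▸ measureReal_singleton_one_le_integral_rpow μ hlam
  filter_upwards [measure_eq_zero_iff_ae_notMem.1 hzero, measure_eq_zero_iff_ae_notMem.1 hone]
    with z hz0 hz1
  exact ⟨unitInterval.pos_iff_ne_zero.2 hz0, unitInterval.lt_one_iff_ne_one.2 hz1⟩

end UnitInterval

/-- `η` is the one-sided stable law of index `s`: the distribution at time `1` of the
`s`-stable subordinator. -/
structure IsStableLaw (s : ℝ) (η : Measure ℝ) : Prop where
  isProbabilityMeasure : IsProbabilityMeasure η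
  ae_pos : ∀ᵐ τ ∂η, 0 < τ
  laplace : ∀ lam : ℝ, 0 ≤ lam → ∫ τ, exp (-(lam * τ)) ∂η = exp (-lam ^ s)

lemma exists_isStableLaw (hs0 : 0 < s) (hs1 : s < 1) : ∃ η : Measure ℝ, IsStableLaw s η := by
  obtain ⟨μ, hμ⟩ := exists_probabilityMeasure_unitInterval_integral_rpow_eq hs0 hs1
  have hae := ae_mem_Ioo_of_integral_rpow_eq (μ : Measure unitInterval) hs0 hμ
  have hmeas : Measurable fun z : unitInterval => -log (z : ℝ) := by fun_prop
  have hprob := Measure.isProbabilityMeasure_map (μ := (μ : Measure unitInterval))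
    hmeas.aemeasurable
  refine ⟨_, hprob, ?_, fun lam hlam => ?_⟩
  · refine (ae_map_iff hmeas.aemeasurable measurableSet_Ioi).2 (hae.mono fun z hz => ?_)
    exact neg_pos.2 (log_neg hz.1 hz.2)
  · rcases hlam.eq_or_lt with rfl | hlam
    · simp [zero_rpow hs0.ne']
    · rw [← hμ lam hlam, integral_map hmeas.aemeasurable (by fun_prop)]
      refine integral_congr_ae (hae.mono fun z hz => ?_)
      simp only [rpow_def_of_pos hz.1]
      ring_nf

end StableLaw

lemma div_one_add_le_one_sub_exp_neg {x : ℝ} (hx : 0 ≤ x) : x / (1 + x) ≤ 1 - exp (-x) := by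
  have hle : exp (-x) ≤ (1 + x)⁻¹ := by
    rw [exp_neg]
    gcongr
    linarith [add_one_le_exp x]
  have heq : x / (1 + x) = 1 - (1 + x)⁻¹ := by field_simp; ring
  linarith

lemma min_div_two_le_one_sub_exp_neg {x : ℝ} (hx : 0 ≤ x) : min x 1 / 2 ≤ 1 - exp (-x) := by
  refine le_trans ?_ (div_one_add_le_one_sub_exp_neg hx)
  rw [div_le_div_iff₀ two_pos (by positivity)]
  rcases min_cases x 1 with ⟨hmin, hle⟩ | ⟨hmin, hle⟩ <;> rw [hmin] <;> nlinarith

lemma one_sub_exp_neg_nonneg {x : ℝ} (hx : 0 ≤ x) : 0 ≤ 1 - exp (-x) :=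
  sub_nonneg.2 (exp_le_one_iff.2 (neg_nonpos.2 hx))

lemma one_sub_exp_neg_le (x : ℝ) : 1 - exp (-x) ≤ x := by
  linarith [add_one_le_exp (-x)]

lemma one_sub_exp_neg_le_add_indicator_Ioc {a K δ τ : ℝ} (ha : 0 < a) (hK : 0 < K) (hδ : 0 ≤ δ)
    (hτ : 0 ≤ τ) :
    1 - exp (-(δ / a * τ)) ≤ 2 * δ * (1 - exp (-(1 / a * τ)))
      + 2 * (1 - exp (-(1 / (K * a) * τ))) + indicator (Ioc a (K * a)) 1 τ := by
  have hnonneg₁ : 0 ≤ 2 * δ * (1 - exp (-(1 / a * τ))) :=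
    mul_nonneg (by positivity) (one_sub_exp_neg_nonneg (by positivity))
  have hnonneg₂ : 0 ≤ 1 - exp (-(1 / (K * a) * τ)) := one_sub_exp_neg_nonneg (by positivity)
  have hnonneg₃ : (0 : ℝ) ≤ indicator (Ioc a (K * a)) 1 τ := indicator_nonneg (by simp) _
  have hexp := exp_pos (-(δ / a * τ))
  rcases le_or_gt τ a with hτa | hτa
  · have hlin : 1 / a * τ / 2 ≤ 1 - exp (-(1 / a * τ)) := by
      have hle : 1 / a * τ ≤ 1 := by rwa [one_div, inv_mul_le_iff₀ ha, mul_one]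
      simpa only [min_eq_left hle] using
        min_div_two_le_one_sub_exp_neg (x := 1 / a * τ) (by positivity)
    calc 1 - exp (-(δ / a * τ)) ≤ δ / a * τ := one_sub_exp_neg_le _
      _ = 2 * δ * (1 / a * τ / 2) := by ring
      _ ≤ 2 * δ * (1 - exp (-(1 / a * τ))) := by gcongr
      _ ≤ _ := by linarith
  rcases le_or_gt τ (K * a) with hτK | hτK
  · have hone : indicator (Ioc a (K * a)) (1 : ℝ → ℝ) τ = 1 :=
      indicator_of_mem (mem_Ioc.2 ⟨hτa, hτK⟩) _
    linarith
  · have hhalf : 1 / 2 ≤ 1 - exp (-(1 / (K * a) * τ)) := by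
      have hle : 1 ≤ 1 / (K * a) * τ := by
        rw [one_div, le_inv_mul_iff₀ (by positivity), mul_one]
        exact hτK.le
      simpa only [min_eq_right hle] using
        min_div_two_le_one_sub_exp_neg (x := 1 / (K * a) * τ) (by positivity)
    linarith

namespace IsStableLaw

variable {s : ℝ} {η : Measure ℝ}

lemma integrable_exp_neg_mul (h : IsStableLaw s η) {lam : ℝ} (hlam : 0 ≤ lam) :
    Integrable (fun τ => exp (-(lam * τ))) η := by
  have := h.isProbabilityMeasure
  refine Integrable.of_bound (C := 1) (by fun_prop) (h.ae_pos.mono fun τ hτ => ?_)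
  rw [norm_of_nonneg (exp_pos _).le, exp_le_one_iff, neg_nonpos]
  positivity

lemma integrable_one_sub_exp_neg_mul (h : IsStableLaw s η) {lam : ℝ} (hlam : 0 ≤ lam) :
    Integrable (fun τ => 1 - exp (-(lam * τ))) η :=
  have := h.isProbabilityMeasure
  (integrable_const _).sub (h.integrable_exp_neg_mul hlam)

lemma integral_one_sub_exp_neg_mul (h : IsStableLaw s η) {lam : ℝ} (hlam : 0 ≤ lam) :
    ∫ τ, (1 - exp (-(lam * τ))) ∂η = 1 - exp (-lam ^ s) := by
  have := h.isProbabilityMeasure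
  rw [integral_sub (integrable_const _) (h.integrable_exp_neg_mul hlam), h.laplace lam hlam]
  simp

lemma integral_one_sub_exp_neg_mul_le (h : IsStableLaw s η) {lam : ℝ} (hlam : 0 ≤ lam) :
    ∫ τ, (1 - exp (-(lam * τ))) ∂η ≤ lam ^ s :=
  (h.integral_one_sub_exp_neg_mul hlam).trans_le (one_sub_exp_neg_le _)

/- `Γ(p) τ^(-p) = ∫ lam^(p-1) exp (-lam τ) dlam`, so by Tonelli the negative moment of order `p`
is a multiple of `∫ lam^(p-1) exp (-lam^s) dlam`. -/
lemma integrable_rpow_neg (h : IsStableLaw s η) (hs0 : 0 < s) {p : ℝ} (hp : 0 ≤ p) :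
    Integrable (fun τ => τ ^ (-p)) η := by
  have := h.isProbabilityMeasure
  rcases hp.eq_or_lt with rfl | hp
  · simp
  have hprod : Integrable (fun q : ℝ × ℝ => q.2 ^ (p - 1) * exp (-(q.2 * q.1)))
      (η.prod (volume.restrict (Ioi 0))) := by
    rw [integrable_prod_iff' (by fun_prop)]
    constructor
    · refine ae_restrict_of_forall_mem measurableSet_Ioi fun lam hlam => ?_
      exact (h.integrable_exp_neg_mul (le_of_lt hlam)).const_mul (lam ^ (p - 1))
    · refine (integrableOn_rpow_mul_exp_neg_rpow (s := p - 1) (by linarith) hs0).congr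
        (ae_restrict_of_forall_mem measurableSet_Ioi fun lam (hlam : 0 < lam) => ?_)
      simp only [← h.laplace lam hlam.le, ← integral_const_mul]
      refine integral_congr_ae (.of_forall fun τ => ?_)
      exact (norm_of_nonneg (by positivity)).symm
  refine (hprod.integral_prod_left.mul_const (Gamma p)⁻¹).congr (h.ae_pos.mono fun τ hτ => ?_)
  have hΓ := (Gamma_pos_of_pos hp).ne'
  simp only [mul_comm _ τ]
  rw [integral_rpow_mul_exp_neg_mul_Ioi hp hτ, mul_inv_cancel_right₀ hΓ, one_div,
    inv_rpow hτ.le, rpow_neg hτ.le]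

lemma one_sub_exp_neg_rpow_le_add_measureReal_Ioc (h : IsStableLaw s η) {a K δ : ℝ} (ha : 0 < a)
    (hK : 0 < K) (hδ : 0 ≤ δ) :
    1 - exp (-(δ / a) ^ s)
      ≤ 2 * δ * (1 / a) ^ s + 2 * (1 / (K * a)) ^ s + η.real (Ioc a (K * a)) := by
  have := h.isProbabilityMeasure
  have ha' : 0 ≤ 1 / a := by positivity
  have hKa : 0 ≤ 1 / (K * a) := by positivity
  have hδa : 0 ≤ δ / a := by positivity
  have hint₁ := (h.integrable_one_sub_exp_neg_mul ha').const_mul (2 * δ)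
  have hint₂ := (h.integrable_one_sub_exp_neg_mul hKa).const_mul 2
  have hint₃ : Integrable (indicator (Ioc a (K * a)) (1 : ℝ → ℝ)) η :=
    (integrable_const (1 : ℝ)).indicator measurableSet_Ioc
  calc 1 - exp (-(δ / a) ^ s) = ∫ τ, (1 - exp (-(δ / a * τ))) ∂η :=
        (h.integral_one_sub_exp_neg_mul hδa).symm
    _ ≤ ∫ τ, (2 * δ * (1 - exp (-(1 / a * τ))) + 2 * (1 - exp (-(1 / (K * a) * τ)))
          + indicator (Ioc a (K * a)) (1 : ℝ → ℝ) τ) ∂η :=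
        integral_mono_ae (h.integrable_one_sub_exp_neg_mul hδa) ((hint₁.add hint₂).add hint₃)
          (h.ae_pos.mono fun τ hτ => one_sub_exp_neg_le_add_indicator_Ioc ha hK hδ hτ.le)
    _ = 2 * δ * ∫ τ, (1 - exp (-(1 / a * τ))) ∂η
          + 2 * ∫ τ, (1 - exp (-(1 / (K * a) * τ))) ∂η + η.real (Ioc a (K * a)) := by
        rw [← integral_const_mul, ← integral_const_mul, ← integral_indicator_one measurableSet_Ioc,
          ← integral_add hint₁ hint₂]
        exact integral_add (hint₁.add hint₂) hint₃
    _ ≤ _ := by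
        gcongr
        · exact h.integral_one_sub_exp_neg_mul_le ha'
        · exact h.integral_one_sub_exp_neg_mul_le hKa

lemma exists_mul_rpow_le_measureReal_Ioc (h : IsStableLaw s η) (hs0 : 0 < s) (hs1 : s < 1) :
    ∃ c K : ℝ, 0 < c ∧ 0 < K ∧ ∀ a : ℝ, 1 ≤ a → c * a ^ (-s) ≤ η.real (Ioc a (K * a)) := by
  have hs1' : 0 < 1 - s := by linarith
  set δ : ℝ := (1 / 16) ^ (1 / (1 - s)) with hδ
  have hδ0 : 0 < δ := by positivity
  have hδs : δ = δ ^ s / 16 := by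
    calc δ = δ ^ s * δ ^ (1 - s) := by rw [← rpow_add hδ0, add_sub_cancel, rpow_one]
      _ = δ ^ s / 16 := by
        rw [hδ, ← rpow_mul (by norm_num) (1 / (1 - s)) (1 - s), one_div_mul_cancel hs1'.ne',
          rpow_one, mul_one_div]
  have hδs1 : δ ^ s ≤ 1 :=
    rpow_le_one hδ0.le (rpow_le_one (by norm_num) (by norm_num) (by positivity)) hs0.le
  obtain ⟨K, hKs, hK⟩ := (((tendsto_rpow_neg_atTop hs0).eventually_le_const
    (show 0 < δ ^ s / 16 by positivity)).and (eventually_gt_atTop 0)).exists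
  refine ⟨δ ^ s / 4, K, by positivity, hK, fun a ha => ?_⟩
  have ha0 : 0 < a := by linarith
  have hblock := h.one_sub_exp_neg_rpow_le_add_measureReal_Ioc ha0 hK hδ0.le
  have hlower : δ ^ s * a ^ (-s) / 2 ≤ 1 - exp (-(δ ^ s * a ^ (-s))) := by
    have hle : δ ^ s * a ^ (-s) ≤ 1 :=
      mul_le_one₀ hδs1 (by positivity) (rpow_le_one_of_one_le_of_nonpos ha (by linarith))
    simpa only [min_eq_left hle] using
      min_div_two_le_one_sub_exp_neg (x := δ ^ s * a ^ (-s)) (by positivity)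
  have hpow_a : (1 / a) ^ s = a ^ (-s) := by rw [one_div, inv_rpow ha0.le, rpow_neg ha0.le]
  have hpow_δ : (δ / a) ^ s = δ ^ s * a ^ (-s) := by
    rw [div_rpow hδ0.le ha0.le, rpow_neg ha0.le, div_eq_mul_inv]
  have hpow_K : (1 / (K * a)) ^ s = K ^ (-s) * a ^ (-s) := by
    rw [one_div, inv_rpow (by positivity), ← rpow_neg (by positivity), mul_rpow hK.le ha0.le]
  rw [hpow_a, hpow_δ, hpow_K] at hblock
  have hδ_mul : 2 * δ * a ^ (-s) = δ ^ s / 8 * a ^ (-s) := by linear_combination 2 * a ^ (-s) * hδs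
  have hK_mul : K ^ (-s) * a ^ (-s) ≤ δ ^ s / 16 * a ^ (-s) := by gcongr
  linarith

end IsStableLaw

/-! ### Second-order Taylor remainders of Gaussians -/

lemma exp_sub_one_sub_le (x : ℝ) : exp x - 1 - x ≤ x ^ 2 * max 1 (exp x) := by
  have hinv : exp (-x) * exp x = 1 := by rw [← exp_add, neg_add_cancel, exp_zero]
  have hle : exp x - 1 ≤ x * exp x := by nlinarith [exp_pos x, add_one_le_exp (-x)]
  rcases le_total 0 x with hx | hx
  · nlinarith [mul_le_mul_of_nonneg_left (le_max_right 1 (exp x)) (sq_nonneg x),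
      add_one_le_exp x]
  · nlinarith [mul_le_mul_of_nonneg_left (le_max_left 1 (exp x)) (sq_nonneg x),
      add_one_le_exp x]

lemma abs_exp_neg_taylor_le {a b m : ℝ} (ha : m ≤ a) (hb : m ≤ b) :
    |exp (-b) - exp (-a) + (b - a) * exp (-a)| ≤ (b - a) ^ 2 * exp (-m) := by
  have hfactor : exp (-b) - exp (-a) + (b - a) * exp (-a)
      = exp (-a) * (exp (a - b) - 1 - (a - b)) := by
    rw [show -b = -a + (a - b) by ring, exp_add]
    ring
  have hnonneg : 0 ≤ exp (a - b) - 1 - (a - b) := by linarith [add_one_le_exp (a - b)]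
  rw [hfactor, abs_of_nonneg (mul_nonneg (exp_pos _).le hnonneg)]
  calc exp (-a) * (exp (a - b) - 1 - (a - b))
      ≤ exp (-a) * ((a - b) ^ 2 * max 1 (exp (a - b))) := by
        gcongr
        exact exp_sub_one_sub_le _
    _ = (b - a) ^ 2 * max (exp (-a)) (exp (-b)) := by
        have hmax : max (exp (-a)) (exp (-b)) = exp (-a) * max 1 (exp (a - b)) := by
          rw [mul_max_of_nonneg _ _ (exp_pos _).le, ← exp_add]
          ring_nf
        rw [hmax]
        ring
    _ ≤ (b - a) ^ 2 * exp (-m) := by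
        gcongr
        exact max_le (exp_le_exp.2 (by linarith)) (exp_le_exp.2 (by linarith))

section Gaussian

variable {V : Type*} [NormedAddCommGroup V] [InnerProductSpace ℝ V]

/-- The heat kernel on `V` at time `τ`. -/
def gauss (τ : ℝ) (z : V) : ℝ :=
  (4 * π * τ) ^ (-(finrank ℝ V / 2 : ℝ)) * exp (-(‖z‖ ^ 2 / (4 * τ)))

/-- The second-order Taylor remainder of the heat kernel at `z` with increment `-k`. -/
def gaussTaylorRemainder (τ : ℝ) (z k : V) : ℝ :=
  gauss τ (z - k) - gauss τ z - gauss τ z / (2 * τ) * inner ℝ z k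

lemma gauss_nonneg {τ : ℝ} (hτ : 0 ≤ τ) (z : V) : 0 ≤ gauss τ z := by
  unfold gauss
  positivity

lemma measurable_gauss (z : V) : Measurable fun τ : ℝ => gauss τ z := by
  unfold gauss
  fun_prop

lemma four_pi_mul_rpow_neg_le {τ p : ℝ} (hτ : 0 < τ) (hp : 0 ≤ p) :
    (4 * π * τ) ^ (-p) ≤ τ ^ (-p) := by
  refine rpow_le_rpow_of_nonpos hτ ?_ (neg_nonpos.2 hp)
  nlinarith [pi_gt_three]

lemma gauss_le_rpow {τ : ℝ} (hτ : 0 < τ) (z : V) : gauss τ z ≤ τ ^ (-(finrank ℝ V / 2 : ℝ)) := by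
  have hexp : exp (-(‖z‖ ^ 2 / (4 * τ))) ≤ 1 := by
    rw [exp_le_one_iff, neg_nonpos]
    positivity
  exact (mul_le_of_le_one_right (by positivity) hexp).trans
    (four_pi_mul_rpow_neg_le hτ (by positivity))

lemma sq_norm_sub_sq_sub_norm_sq_le (z : V) {k : V} (hk : ‖k‖ ≤ 1) :
    (‖z - k‖ ^ 2 - ‖z‖ ^ 2) ^ 2 ≤ (‖k‖ * (1 + 2 * ‖z‖)) ^ 2 := by
  have hinner := abs_le.1 (abs_real_inner_le_norm z k)
  rw [norm_sub_sq_real]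
  refine sq_le_sq' ?_ ?_ <;> nlinarith [norm_nonneg k, norm_nonneg z]

lemma abs_gaussTaylorRemainder_le {τ : ℝ} (hτ : 0 < τ) (z : V) {k : V} (hk : ‖k‖ ≤ 1) {q : ℝ}
    (hq0 : 0 ≤ q) (hqz : q ≤ ‖z‖) (hqk : q ≤ ‖z - k‖) :
    |gaussTaylorRemainder τ z k|
      ≤ ‖k‖ ^ 2 * (τ ^ (-(finrank ℝ V / 2 : ℝ)) * ((1 + 2 * ‖z‖) ^ 2 / τ ^ 2 + 1 / τ)
        * exp (-(q ^ 2 / (4 * τ)))) := by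
  set g := (4 * π * τ) ^ (-(finrank ℝ V / 2 : ℝ)) with hg
  set a := ‖z‖ ^ 2 / (4 * τ) with ha
  set b := ‖z - k‖ ^ 2 / (4 * τ) with hb
  set m := q ^ 2 / (4 * τ) with hm
  have hma : m ≤ a := by rw [hm, ha]; gcongr
  have hmb : m ≤ b := by rw [hm, hb]; gcongr
  have hsplit : gaussTaylorRemainder τ z k
      = g * ((exp (-b) - exp (-a) + (b - a) * exp (-a)) - ‖k‖ ^ 2 / (4 * τ) * exp (-a)) := by
    have hba : b - a = (‖k‖ ^ 2 - 2 * inner ℝ z k) / (4 * τ) := by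
      rw [ha, hb, norm_sub_sq_real]; ring
    rw [hba]
    simp only [gaussTaylorRemainder, gauss, ← hg, ← ha, ← hb]
    field_simp
    ring
  have hsq : (b - a) ^ 2 ≤ ‖k‖ ^ 2 * ((1 + 2 * ‖z‖) ^ 2 / τ ^ 2) := by
    rw [ha, hb, ← sub_div, div_pow, ← mul_div_assoc, ← mul_pow]
    exact div_le_div₀ (by positivity) (sq_norm_sub_sq_sub_norm_sq_le z hk) (by positivity)
      (by gcongr; linarith)
  rw [hsplit, abs_mul, abs_of_nonneg (by positivity : 0 ≤ g)]
  calc g * |(exp (-b) - exp (-a) + (b - a) * exp (-a)) - ‖k‖ ^ 2 / (4 * τ) * exp (-a)|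
      ≤ g * ((b - a) ^ 2 * exp (-m) + ‖k‖ ^ 2 / (4 * τ) * exp (-m)) := by
        gcongr
        refine (abs_sub _ _).trans (add_le_add (abs_exp_neg_taylor_le hma hmb) ?_)
        rw [abs_of_nonneg (by positivity)]
        gcongr
    _ ≤ τ ^ (-(finrank ℝ V / 2 : ℝ)) * (‖k‖ ^ 2 * ((1 + 2 * ‖z‖) ^ 2 / τ ^ 2) * exp (-m)
          + ‖k‖ ^ 2 / τ * exp (-m)) := by
        gcongr
        · exact four_pi_mul_rpow_neg_le hτ (by positivity)
        · linarith
    _ = _ := by ring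

lemma rpow_neg_add_one {τ : ℝ} (hτ : 0 < τ) (p : ℝ) : τ ^ (-(p + 1)) = τ ^ (-p) * (1 / τ) := by
  rw [neg_add, ← sub_eq_add_neg, rpow_sub_one hτ.ne', mul_one_div]

lemma rpow_neg_add_two {τ : ℝ} (hτ : 0 < τ) (p : ℝ) :
    τ ^ (-(p + 2)) = τ ^ (-p) * (1 / τ ^ 2) := by
  rw [neg_add, rpow_add hτ, rpow_neg hτ.le 2, rpow_two, one_div]

lemma abs_gaussTaylorRemainder_le_of_norm_le_two {τ : ℝ} (hτ : 0 < τ) {z k : V} (hz : ‖z‖ ≤ 2)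
    (hk : ‖k‖ ≤ 1) :
    |gaussTaylorRemainder τ z k| ≤ ‖k‖ ^ 2 *
      (25 * τ ^ (-(finrank ℝ V / 2 + 2 : ℝ)) + τ ^ (-(finrank ℝ V / 2 + 1 : ℝ))) := by
  have hsq : (1 + 2 * ‖z‖) ^ 2 ≤ 25 := by nlinarith [norm_nonneg z]
  calc |gaussTaylorRemainder τ z k|
      ≤ ‖k‖ ^ 2 * (τ ^ (-(finrank ℝ V / 2 : ℝ)) * ((1 + 2 * ‖z‖) ^ 2 / τ ^ 2 + 1 / τ)
        * exp (-(0 ^ 2 / (4 * τ)))) :=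
        abs_gaussTaylorRemainder_le hτ z hk le_rfl (norm_nonneg _) (norm_nonneg _)
    _ = ‖k‖ ^ 2 * (τ ^ (-(finrank ℝ V / 2 : ℝ)) * ((1 + 2 * ‖z‖) ^ 2 / τ ^ 2 + 1 / τ)) := by simp
    _ ≤ ‖k‖ ^ 2 * (τ ^ (-(finrank ℝ V / 2 : ℝ)) * (25 / τ ^ 2 + 1 / τ)) := by gcongr
    _ = _ := by
        rw [rpow_neg_add_one hτ, rpow_neg_add_two hτ]
        ring

lemma exists_rpow_mul_exp_neg_mul_le {q b : ℝ} (hq : 0 ≤ q) (hb : 0 < b) :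
    ∃ C : ℝ, 0 < C ∧ ∀ w : ℝ, 0 < w → w ^ q * exp (-(b * w)) ≤ C * (1 - exp (-(1 / w))) := by
  obtain ⟨m, hm⟩ := exists_nat_ge (q + 1)
  refine ⟨m.factorial / b ^ m * exp b, by positivity, fun w hw => ?_⟩
  have hpow : w ^ q * (1 + w) ≤ (1 + w) ^ m := by
    calc w ^ q * (1 + w) ≤ (1 + w) ^ q * (1 + w) := by gcongr; linarith
      _ = (1 + w) ^ (q + 1) := (rpow_add_one (by positivity) q).symm
      _ ≤ (1 + w) ^ m := by
        rw [← rpow_natCast]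
        exact rpow_le_rpow_of_exponent_le (by linarith) hm
  have hexp : (1 + w) ^ m ≤ m.factorial / b ^ m * (exp b * exp (b * w)) := by
    have hle := pow_div_factorial_le_exp (b * (1 + w)) (by positivity) m
    rw [div_le_iff₀ (by positivity), mul_pow, mul_add, mul_one, exp_add] at hle
    rw [div_mul_eq_mul_div, le_div_iff₀ (by positivity)]
    linarith
  calc w ^ q * exp (-(b * w)) = w ^ q * (1 + w) * exp (-(b * w)) * (1 / (1 + w)) := by field_simp
    _ ≤ m.factorial / b ^ m * (exp b * exp (b * w)) * exp (-(b * w)) * (1 / (1 + w)) := by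
        gcongr ?_ * _ * _
        exact hpow.trans hexp
    _ = m.factorial / b ^ m * exp b * (1 / w / (1 + 1 / w)) := by
        rw [exp_neg]
        field_simp
        ring
    _ ≤ _ := by
        gcongr
        exact div_one_add_le_one_sub_exp_neg (by positivity)

lemma exists_rpow_neg_mul_exp_neg_le {p b : ℝ} (hp : 0 ≤ p) (hb : 0 < b) :
    ∃ C : ℝ, 0 < C ∧ ∀ r τ : ℝ, 0 < r → 0 < τ →
      τ ^ (-p) * exp (-(b * (r ^ 2 / τ))) ≤ C * r ^ (-(2 * p)) * (1 - exp (-(1 / r ^ 2 * τ))) := by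
  obtain ⟨C, hC, hle⟩ := exists_rpow_mul_exp_neg_mul_le hp hb
  refine ⟨C, hC, fun r τ hr hτ => ?_⟩
  have hpow : τ ^ (-p) = r ^ (-(2 * p)) * (r ^ 2 / τ) ^ p := by
    rw [div_rpow (by positivity) hτ.le, ← rpow_natCast r 2, ← rpow_mul hr.le, ← mul_div_assoc,
      ← rpow_add hr, rpow_neg hτ.le, ← one_div]
    congr 1
    simp
  calc τ ^ (-p) * exp (-(b * (r ^ 2 / τ)))
      = r ^ (-(2 * p)) * ((r ^ 2 / τ) ^ p * exp (-(b * (r ^ 2 / τ)))) := by rw [hpow, mul_assoc]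
    _ ≤ r ^ (-(2 * p)) * (C * (1 - exp (-(1 / (r ^ 2 / τ))))) := by
        gcongr _ * ?_
        exact hle (r ^ 2 / τ) (div_pos (pow_pos hr 2) hτ)
    _ = _ := by
        rw [one_div_div, div_eq_inv_mul, one_div]
        ring

variable (V) in
lemma exists_abs_gaussTaylorRemainder_le_of_two_le_norm :
    ∃ C : ℝ, 0 < C ∧ ∀ (τ : ℝ) (z k : V), 0 < τ → 2 ≤ ‖z‖ → ‖k‖ ≤ 1 →
      |gaussTaylorRemainder τ z k| ≤ ‖k‖ ^ 2 *
        (C * ‖z‖ ^ (-(finrank ℝ V + 2 : ℝ)) * (1 - exp (-(1 / ‖z‖ ^ 2 * τ)))) := by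
  obtain ⟨C₁, hC₁, hle₁⟩ := exists_rpow_neg_mul_exp_neg_le
    (p := finrank ℝ V / 2 + 1) (b := 1 / 16) (by positivity) (by norm_num)
  obtain ⟨C₂, hC₂, hle₂⟩ := exists_rpow_neg_mul_exp_neg_le
    (p := finrank ℝ V / 2 + 2) (b := 1 / 16) (by positivity) (by norm_num)
  refine ⟨9 * C₂ + C₁, by positivity, fun τ z k hτ hz hk => ?_⟩
  set r := ‖z‖ with hr
  have hr0 : 0 < r := by linarith
  specialize hle₁ r τ hr0 hτ
  specialize hle₂ r τ hr0 hτ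
  have hsq : (1 + 2 * r) ^ 2 ≤ 9 * r ^ 2 := by nlinarith
  have hrk : r / 2 ≤ ‖z - k‖ := by linarith [norm_sub_norm_le z k]
  have hexp : exp (-((r / 2) ^ 2 / (4 * τ))) = exp (-(1 / 16 * (r ^ 2 / τ))) := by
    congr 1
    ring
  have hpow₁ : r ^ (-(2 * (finrank ℝ V / 2 + 1) : ℝ)) = r ^ (-(finrank ℝ V + 2 : ℝ)) := by
    congr 1
    ring
  have hpow₂ : r ^ (-(2 * (finrank ℝ V / 2 + 2) : ℝ))
      = r ^ (-(finrank ℝ V + 2 : ℝ)) * (1 / r ^ 2) := by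
    rw [← rpow_neg_add_two hr0]
    congr 1
    ring
  rw [rpow_neg_add_one hτ, hpow₁] at hle₁
  rw [rpow_neg_add_two hτ, hpow₂] at hle₂
  refine (abs_gaussTaylorRemainder_le hτ z hk (q := r / 2) (by positivity) (by linarith)
    hrk).trans (mul_le_mul_of_nonneg_left ?_ (by positivity))
  rw [hexp, ← hr]
  set G := τ ^ (-(finrank ℝ V / 2 : ℝ))
  set e := exp (-(1 / 16 * (r ^ 2 / τ)))
  calc G * ((1 + 2 * r) ^ 2 / τ ^ 2 + 1 / τ) * e
      ≤ G * (9 * r ^ 2 / τ ^ 2 + 1 / τ) * e := by gcongr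
    _ = 9 * r ^ 2 * (G * (1 / τ ^ 2) * e) + G * (1 / τ) * e := by ring
    _ ≤ 9 * r ^ 2 * (C₂ * (r ^ (-(finrank ℝ V + 2 : ℝ)) * (1 / r ^ 2))
          * (1 - exp (-(1 / r ^ 2 * τ))))
        + C₁ * r ^ (-(finrank ℝ V + 2 : ℝ)) * (1 - exp (-(1 / r ^ 2 * τ))) := by gcongr
    _ = _ := by field_simp

end Gaussian

/-! ### Gaussian mixtures of the stable law -/

section GaussMixture

variable {V : Type*} [NormedAddCommGroup V] [InnerProductSpace ℝ V]

/-- The density on `V` obtained by choosing the time `τ` of the heat kernel at random with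
law `η`. -/
def gaussMixture (η : Measure ℝ) (z : V) : ℝ := ∫ τ, gauss τ z ∂η

/-- The scalar `w` for which `-w • z` is the gradient of `gaussMixture η` at `z`. -/
def gaussMixtureSlope (η : Measure ℝ) (z : V) : ℝ := ∫ τ, gauss τ z / (2 * τ) ∂η

namespace IsStableLaw

variable {s : ℝ} {η : Measure ℝ}

lemma integrable_gauss (h : IsStableLaw s η) (hs0 : 0 < s) (z : V) :
    Integrable (fun τ => gauss τ z) η := by
  refine (h.integrable_rpow_neg hs0 (p := finrank ℝ V / 2) (by positivity)).mono'
    (measurable_gauss z).aestronglyMeasurable ?_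
  filter_upwards [h.ae_pos] with τ hτ
  rw [norm_of_nonneg (gauss_nonneg hτ.le z)]
  exact gauss_le_rpow hτ z

lemma integrable_gauss_div (h : IsStableLaw s η) (hs0 : 0 < s) (z : V) :
    Integrable (fun τ => gauss τ z / (2 * τ)) η := by
  refine (h.integrable_rpow_neg hs0 (p := finrank ℝ V / 2 + 1) (by positivity)).mono'
    ((measurable_gauss z).div (by fun_prop)).aestronglyMeasurable ?_
  filter_upwards [h.ae_pos] with τ hτ
  have hnonneg := gauss_nonneg hτ.le z
  rw [norm_of_nonneg (by positivity), rpow_neg_add_one hτ, div_eq_mul_one_div]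
  gcongr
  · exact gauss_le_rpow hτ z
  · linarith

lemma gaussMixture_nonneg (h : IsStableLaw s η) (z : V) : 0 ≤ gaussMixture η z :=
  integral_nonneg_of_ae (h.ae_pos.mono fun _ hτ => gauss_nonneg (le_of_lt hτ) z)

variable (V) in
lemma exists_mul_rpow_le_gaussMixture (h : IsStableLaw s η) (hs0 : 0 < s) (hs1 : s < 1) :
    ∃ c : ℝ, 0 < c ∧ ∀ (z : V) (ρ : ℝ), 1 ≤ ρ → ‖z‖ ≤ ρ →
      c * ρ ^ (-(finrank ℝ V + 2 * s)) ≤ gaussMixture η z := by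
  have := h.isProbabilityMeasure
  obtain ⟨c, K, hc, hK, hmass⟩ := h.exists_mul_rpow_le_measureReal_Ioc hs0 hs1
  set D : ℝ := -(finrank ℝ V / 2 : ℝ) with hD
  refine ⟨(4 * π * K) ^ D * exp (-(1 / 4)) * c, by positivity, fun z ρ hρ hz => ?_⟩
  have hρ0 : 0 < ρ := by linarith
  set b : ℝ := (4 * π * (K * ρ ^ 2)) ^ D * exp (-(1 / 4)) with hb
  have hle : ∀ᵐ τ ∂η, indicator (Ioc (ρ ^ 2) (K * ρ ^ 2)) (fun _ => b) τ ≤ gauss τ z := by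
    filter_upwards [h.ae_pos] with τ hτ
    refine indicator_apply_le' (fun hmem => ?_) fun _ => gauss_nonneg hτ.le z
    have hexp : ‖z‖ ^ 2 / (4 * τ) ≤ 1 / 4 := by
      rw [div_le_div_iff₀ (by positivity) (by norm_num)]
      nlinarith [hmem.1, pow_le_pow_left₀ (norm_nonneg z) hz 2]
    refine mul_le_mul (rpow_le_rpow_of_nonpos (by positivity) ?_ ?_)
      (exp_le_exp.2 (neg_le_neg hexp)) (exp_pos _).le (by positivity)
    · gcongr
      exact hmem.2
    · rw [neg_nonpos]
      positivity
  have hpow (p : ℝ) : (ρ ^ 2) ^ p = ρ ^ (2 * p) := by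
    rw [← rpow_two, ← rpow_mul hρ0.le]
  calc (4 * π * K) ^ D * exp (-(1 / 4)) * c * ρ ^ (-(finrank ℝ V + 2 * s))
      = c * (ρ ^ 2) ^ (-s) * b := by
        rw [hb, ← mul_assoc (4 * π), mul_rpow (y := ρ ^ 2) (by positivity) (by positivity),
          hpow, hpow,
          show -(finrank ℝ V + 2 * s) = 2 * D + 2 * -s by rw [hD]; ring, rpow_add hρ0]
        ring
    _ ≤ η.real (Ioc (ρ ^ 2) (K * ρ ^ 2)) * b := by
        gcongr
        exact hmass _ (one_le_pow₀ hρ)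
    _ = ∫ τ, indicator (Ioc (ρ ^ 2) (K * ρ ^ 2)) (fun _ => b) τ ∂η := by
        rw [integral_indicator_const _ measurableSet_Ioc, smul_eq_mul]
    _ ≤ gaussMixture η z := integral_mono_ae ((integrable_const b).indicator measurableSet_Ioc)
        (h.integrable_gauss hs0 z) hle

lemma gaussMixture_pos (h : IsStableLaw s η) (hs0 : 0 < s) (hs1 : s < 1) (z : V) :
    0 < gaussMixture η z := by
  obtain ⟨c, hc, hle⟩ := h.exists_mul_rpow_le_gaussMixture V hs0 hs1
  exact lt_of_lt_of_le (by positivity) (hle z _ (le_max_left 1 ‖z‖) (le_max_right 1 ‖z‖))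

lemma integral_gaussTaylorRemainder (h : IsStableLaw s η) (hs0 : 0 < s) (z k : V) :
    ∫ τ, gaussTaylorRemainder τ z k ∂η
      = gaussMixture η (z - k) - gaussMixture η z - gaussMixtureSlope η z * inner ℝ z k := by
  have hsub := (h.integrable_gauss hs0 (z - k)).sub (h.integrable_gauss hs0 z)
  calc ∫ τ, gaussTaylorRemainder τ z k ∂η
      = ∫ τ, (gauss τ (z - k) - gauss τ z) ∂η - ∫ τ, gauss τ z / (2 * τ) * inner ℝ z k ∂η :=
        integral_sub hsub ((h.integrable_gauss_div hs0 z).mul_const _)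
    _ = _ := by
        rw [integral_sub (h.integrable_gauss hs0 _) (h.integrable_gauss hs0 z),
          integral_mul_const]
        rfl

variable (V) in
lemma exists_abs_integral_gaussTaylorRemainder_le_of_norm_le_two (h : IsStableLaw s η)
    (hs0 : 0 < s) (hs1 : s < 1) :
    ∃ C : ℝ, 0 ≤ C ∧ ∀ z k : V, ‖z‖ ≤ 2 → ‖k‖ ≤ 1 →
      |∫ τ, gaussTaylorRemainder τ z k ∂η| ≤ ‖k‖ ^ 2 * (C * gaussMixture η z) := by
  obtain ⟨c, hc, hlow⟩ := h.exists_mul_rpow_le_gaussMixture V hs0 hs1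
  set m : ℝ → ℝ := fun τ =>
    25 * τ ^ (-(finrank ℝ V / 2 + 2 : ℝ)) + τ ^ (-(finrank ℝ V / 2 + 1 : ℝ)) with hm
  have hint : Integrable m η :=
    ((h.integrable_rpow_neg hs0 (p := finrank ℝ V / 2 + 2) (by positivity)).const_mul 25).add
      (h.integrable_rpow_neg hs0 (p := finrank ℝ V / 2 + 1) (by positivity))
  set J := ∫ τ, m τ ∂η
  have hJ : 0 ≤ J := integral_nonneg_of_ae (h.ae_pos.mono fun τ (hτ : 0 < τ) => by
    simp only [Pi.zero_apply, hm]
    positivity)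
  have hc₂ : 0 < c * 2 ^ (-(finrank ℝ V + 2 * s)) := by positivity
  refine ⟨J / (c * 2 ^ (-(finrank ℝ V + 2 * s))), by positivity, fun z k hz hk => ?_⟩
  rw [← norm_eq_abs]
  calc ‖∫ τ, gaussTaylorRemainder τ z k ∂η‖
      ≤ ∫ τ, ‖k‖ ^ 2 * m τ ∂η :=
        norm_integral_le_of_norm_le (hint.const_mul _) (h.ae_pos.mono fun τ hτ =>
          abs_gaussTaylorRemainder_le_of_norm_le_two hτ hz hk)
    _ = ‖k‖ ^ 2 * J := integral_const_mul _ _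
    _ ≤ _ := by
        gcongr
        rw [div_mul_eq_mul_div, le_div_iff₀ hc₂]
        gcongr
        exact hlow z 2 one_le_two hz

variable (V) in
lemma exists_abs_integral_gaussTaylorRemainder_le_of_two_le_norm (h : IsStableLaw s η)
    (hs0 : 0 < s) (hs1 : s < 1) :
    ∃ C : ℝ, 0 ≤ C ∧ ∀ z k : V, 2 ≤ ‖z‖ → ‖k‖ ≤ 1 →
      |∫ τ, gaussTaylorRemainder τ z k ∂η| ≤ ‖k‖ ^ 2 * (C * gaussMixture η z) := by
  obtain ⟨c, hc, hlow⟩ := h.exists_mul_rpow_le_gaussMixture V hs0 hs1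
  obtain ⟨C, hC, hle⟩ := exists_abs_gaussTaylorRemainder_le_of_two_le_norm V
  refine ⟨C / c, by positivity, fun z k hz hk => ?_⟩
  set r := ‖z‖
  have hr0 : 0 < r := by linarith
  have hinv : 0 ≤ 1 / r ^ 2 := by positivity
  have hpow : r ^ (-(finrank ℝ V + 2 : ℝ)) * (1 / r ^ 2) ^ s
      ≤ r ^ (-(finrank ℝ V + 2 * s)) := by
    rw [one_div, ← rpow_two, ← rpow_neg hr0.le, ← rpow_mul hr0.le, ← rpow_add hr0]
    exact rpow_le_rpow_of_exponent_le (by linarith) (by nlinarith)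
  rw [← norm_eq_abs]
  calc ‖∫ τ, gaussTaylorRemainder τ z k ∂η‖
      ≤ ∫ τ, ‖k‖ ^ 2 * (C * r ^ (-(finrank ℝ V + 2 : ℝ)) * (1 - exp (-(1 / r ^ 2 * τ)))) ∂η :=
        norm_integral_le_of_norm_le
          (((h.integrable_one_sub_exp_neg_mul hinv).const_mul _).const_mul _)
          (h.ae_pos.mono fun τ hτ => hle τ z k hτ hz hk)
    _ = ‖k‖ ^ 2 * (C * r ^ (-(finrank ℝ V + 2 : ℝ)) * ∫ τ, (1 - exp (-(1 / r ^ 2 * τ))) ∂η) := by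
        rw [integral_const_mul, integral_const_mul]
    _ ≤ ‖k‖ ^ 2 * (C * r ^ (-(finrank ℝ V + 2 : ℝ)) * (1 / r ^ 2) ^ s) := by
        gcongr
        exact h.integral_one_sub_exp_neg_mul_le hinv
    _ = ‖k‖ ^ 2 * (C / c * (c * (r ^ (-(finrank ℝ V + 2 : ℝ)) * (1 / r ^ 2) ^ s))) := by
        field_simp
    _ ≤ ‖k‖ ^ 2 * (C / c * gaussMixture η z) := by
        gcongr
        refine le_trans ?_ (hlow z r (by linarith) le_rfl)
        gcongr

variable (V) in
lemma exists_abs_gaussMixture_taylor_le (h : IsStableLaw s η) (hs0 : 0 < s) (hs1 : s < 1) :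
    ∃ C : ℝ, 0 ≤ C ∧ ∀ z k : V, ‖k‖ ≤ 1 →
      |gaussMixture η (z - k) - gaussMixture η z - gaussMixtureSlope η z * inner ℝ z k|
        ≤ C * ‖k‖ ^ 2 * gaussMixture η z := by
  obtain ⟨C₁, hC₁, hnear⟩ :=
    h.exists_abs_integral_gaussTaylorRemainder_le_of_norm_le_two V hs0 hs1
  obtain ⟨C₂, -, hfar⟩ :=
    h.exists_abs_integral_gaussTaylorRemainder_le_of_two_le_norm V hs0 hs1
  refine ⟨max C₁ C₂, le_max_of_le_left hC₁, fun z k hk => ?_⟩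
  have hnonneg := h.gaussMixture_nonneg z
  rw [← h.integral_gaussTaylorRemainder hs0, mul_comm _ (‖k‖ ^ 2), mul_assoc]
  rcases le_total ‖z‖ 2 with hz | hz
  · refine (hnear z k hz hk).trans ?_
    gcongr
    exact le_max_left _ _
  · refine (hfar z k hz hk).trans ?_
    gcongr
    exact le_max_right _ _

lemma hasFDerivAt_gaussMixture (h : IsStableLaw s η) (hs0 : 0 < s) (hs1 : s < 1) (z : V) :
    HasFDerivAt (gaussMixture η) (-gaussMixtureSlope η z • innerSL ℝ z) z := by
  obtain ⟨C, -, hle⟩ := h.exists_abs_gaussMixture_taylor_le V hs0 hs1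
  rw [hasFDerivAt_iff_isLittleO_nhds_zero]
  have hO : (fun k : V => gaussMixture η (z + k) - gaussMixture η z
      - (-gaussMixtureSlope η z • innerSL ℝ z) k) =O[𝓝 0] fun k => ‖k‖ ^ 2 := by
    refine Asymptotics.IsBigO.of_bound (C * gaussMixture η z) ?_
    filter_upwards [Metric.closedBall_mem_nhds (0 : V) one_pos] with k hk
    have hle_neg := hle z (-k) (by simpa using hk)
    rw [norm_neg, sub_neg_eq_add, inner_neg_right, mul_right_comm] at hle_neg
    simpa using hle_neg
  exact hO.trans_isLittleO (Asymptotics.isLittleO_norm_pow_id one_lt_two)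

end IsStableLaw

end GaussMixture

/-! ### The fractional heat kernel -/

section Symbol

variable {V : Type*} [NormedAddCommGroup V] {s : ℝ}

/-- The Fourier symbol `(2π‖ξ‖)^(2s)` of the fractional Laplacian. -/
def symbol (s : ℝ) (ξ : V) : ℝ := (2 * π * ‖ξ‖) ^ (2 * s)

lemma symbol_nonneg (s : ℝ) (ξ : V) : 0 ≤ symbol s ξ := by
  unfold symbol
  positivity

lemma continuous_symbol (hs0 : 0 < s) : Continuous (symbol s : V → ℝ) := by
  unfold symbol
  exact Continuous.rpow_const (by fun_prop) fun _ => Or.inr (by positivity)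

lemma symbol_eq_sq_rpow (s : ℝ) (ξ : V) : symbol s ξ = ((2 * π * ‖ξ‖) ^ 2) ^ s := by
  rw [symbol, rpow_mul (by positivity), rpow_two]

lemma symbol_smul [NormedSpace ℝ V] (s : ℝ) {a : ℝ} (ha : 0 ≤ a) (ξ : V) :
    symbol s (a • ξ) = a ^ (2 * s) * symbol s ξ := by
  rw [symbol, symbol, norm_smul, norm_of_nonneg ha, ← mul_rpow ha (by positivity)]
  ring_nf

lemma exists_symbol_add_smul_le [NormedSpace ℝ V] (hs0 : 0 < s) (ξ : V) :
    ∃ C k, ∀ δ ∈ Icc (0 : ℝ) 1, ∀ η : V, symbol s (ξ + δ • η) ≤ C * (1 + ‖η‖ ^ k) := by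
  set k := ⌈2 * s⌉₊
  refine ⟨(2 * π * (1 + ‖ξ‖)) ^ (2 * s) * 2 ^ (k - 1), k, fun δ hδ η => ?_⟩
  have hnorm : ‖ξ + δ • η‖ ≤ (1 + ‖ξ‖) * (1 + ‖η‖) := by
    have h := norm_add_le ξ (δ • η)
    rw [norm_smul, norm_of_nonneg hδ.1] at h
    nlinarith [norm_nonneg ξ, norm_nonneg η, mul_le_mul_of_nonneg_right hδ.2 (norm_nonneg η),
      mul_nonneg (norm_nonneg ξ) (norm_nonneg η)]
  calc symbol s (ξ + δ • η) ≤ (2 * π * (1 + ‖ξ‖) * (1 + ‖η‖)) ^ (2 * s) := by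
        rw [symbol, mul_assoc (2 * π)]
        gcongr
    _ = (2 * π * (1 + ‖ξ‖)) ^ (2 * s) * (1 + ‖η‖) ^ (2 * s) :=
        mul_rpow (by positivity) (by positivity)
    _ ≤ (2 * π * (1 + ‖ξ‖)) ^ (2 * s) * (1 + ‖η‖) ^ k := by
        rw [← rpow_natCast (1 + ‖η‖)]
        gcongr
        · linarith [norm_nonneg η]
        · exact Nat.le_ceil _
    _ ≤ (2 * π * (1 + ‖ξ‖)) ^ (2 * s) * 2 ^ (k - 1) * (1 + ‖η‖ ^ k) := by
        rw [mul_assoc (_ ^ (2 * s))]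
        gcongr
        simpa using add_pow_le zero_le_one (norm_nonneg η) k

end Symbol

section Fourier

variable {V : Type*} [NormedAddCommGroup V] [InnerProductSpace ℝ V] [FiniteDimensional ℝ V]
  [MeasurableSpace V] [BorelSpace V] {s : ℝ}

lemma continuous_fourier_of_integrable {f : V → ℂ} (hf : Integrable f) : Continuous (𝓕 f) :=
  VectorFourier.fourierIntegral_continuous continuous_fourierChar (by exact continuous_inner) hf

lemma norm_fourier_le_integral_norm (f : V → ℂ) (ξ : V) : ‖𝓕 f ξ‖ ≤ ∫ x, ‖f x‖ :=
  VectorFourier.norm_fourierIntegral_le_integral_norm _ _ _ _ _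

lemma integrable_exp_neg_mul_symbol (hs0 : 0 < s) {t : ℝ} (ht : 0 < t) :
    Integrable fun ξ : V => exp (-(t * symbol s ξ)) := by
  rcases subsingleton_or_nontrivial V with hV | hV
  · exact Continuous.integrable_of_hasCompactSupport
      (by have := continuous_symbol (V := V) hs0; fun_prop) (HasCompactSupport.of_compactSpace _)
  have hradial : IntegrableOn
      (fun r : ℝ => r ^ (finrank ℝ V - 1) • exp (-(t * (2 * π * r) ^ (2 * s)))) (Ioi 0) := by
    refine (integrableOn_rpow_mul_exp_neg_mul_rpow (s := (finrank ℝ V - 1 : ℕ)) (p := 2 * s)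
      (b := t * (2 * π) ^ (2 * s)) (neg_one_lt_zero.trans_le (Nat.cast_nonneg _)) (by positivity)
      (by positivity)).congr_fun (fun r (hr : 0 < r) => ?_) measurableSet_Ioi
    simp only [smul_eq_mul, rpow_natCast, mul_rpow (show 0 ≤ 2 * π by positivity) hr.le]
    ring_nf
  exact (integrable_fun_norm_addHaar volume
    (f := fun r => exp (-(t * (2 * π * r) ^ (2 * s))))).2 hradial

lemma integrable_exp_neg_sq_mul {τ : ℝ} (hτ : 0 < τ) :
    Integrable fun ξ : V => exp (-((2 * π * ‖ξ‖) ^ 2 * τ)) := by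
  simpa [symbol_eq_sq_rpow, mul_comm] using integrable_exp_neg_mul_symbol (V := V) one_pos hτ

lemma integral_exp_neg_sq_mul {τ : ℝ} (hτ : 0 < τ) :
    ∫ ξ : V, exp (-((2 * π * ‖ξ‖) ^ 2 * τ)) = (4 * π * τ) ^ (-(finrank ℝ V / 2 : ℝ)) := by
  have hgauss := GaussianFourier.integral_rexp_neg_mul_sq_norm (V := V)
    (b := (2 * π) ^ 2 * τ) (by positivity)
  have hinv : π / ((2 * π) ^ 2 * τ) = (4 * π * τ)⁻¹ := by
    field_simp
    norm_num
  rw [hinv, inv_rpow (by positivity), ← rpow_neg (by positivity)] at hgauss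
  rw [← hgauss]
  exact integral_congr_ae (.of_forall fun ξ => by ring_nf)

lemma fourierInv_exp_neg_sq_mul {τ : ℝ} (hτ : 0 < τ) (x : V) :
    𝓕⁻ (fun ξ : V => ((exp (-((2 * π * ‖ξ‖) ^ 2 * τ)) : ℝ) : ℂ)) x = gauss τ x := by
  have hgauss := fourier_gaussian_innerProductSpace (V := V)
    (b := (((2 * π) ^ 2 * τ : ℝ) : ℂ)) (by rw [Complex.ofReal_re]; positivity) (-x)
  have hinv : (π : ℂ) / (((2 * π) ^ 2 * τ : ℝ) : ℂ) = (((4 * π * τ)⁻¹ : ℝ) : ℂ) := by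
    rw [← Complex.ofReal_div]
    congr 1
    field_simp
    norm_num
  have hpow : (((4 * π * τ)⁻¹ : ℝ) : ℂ) ^ ((finrank ℝ V : ℂ) / 2)
      = (((4 * π * τ) ^ (-(finrank ℝ V / 2 : ℝ)) : ℝ) : ℂ) := by
    rw [rpow_neg (by positivity), ← inv_rpow (by positivity), Complex.ofReal_cpow (by positivity)]
    simp
  rw [hinv, hpow, norm_neg] at hgauss
  rw [fourierInv_eq_fourier_neg]
  convert hgauss using 2
  · ext ξ
    push_cast
    ring_nf
  · unfold gauss
    rw [Complex.ofReal_mul, Complex.ofReal_exp]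
    congr 2
    push_cast
    field_simp
    norm_num

end Fourier

namespace IsStableLaw

variable {s : ℝ} {η : Measure ℝ}

lemma integrable_prod_exp_neg_sq_mul {V : Type*} [NormedAddCommGroup V] [InnerProductSpace ℝ V]
    [FiniteDimensional ℝ V] [MeasurableSpace V] [BorelSpace V] (h : IsStableLaw s η)
    (hs0 : 0 < s) :
    Integrable (fun q : ℝ × V => exp (-((2 * π * ‖q.2‖) ^ 2 * q.1))) (η.prod volume) := by
  have := h.isProbabilityMeasure
  rw [integrable_prod_iff (by fun_prop)]
  constructor
  · filter_upwards [h.ae_pos] with τ hτ using integrable_exp_neg_sq_mul hτ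
  · refine (h.integrable_gauss hs0 (0 : V)).congr ?_
    filter_upwards [h.ae_pos] with τ hτ
    simp only [norm_of_nonneg (exp_pos _).le]
    rw [integral_exp_neg_sq_mul hτ]
    simp [gauss]

lemma kernel_one_eq_gaussMixture {n : ℕ} (h : IsStableLaw s η) (hs0 : 0 < s) (x : E n) :
    kernel s 1 x = gaussMixture η x := by
  have := h.isProbabilityMeasure
  have hlaplace (ξ : E n) : ((exp (-(1 * (2 * π * ‖ξ‖) ^ (2 * s))) : ℝ) : ℂ)
      = ∫ τ, ((exp (-((2 * π * ‖ξ‖) ^ 2 * τ)) : ℝ) : ℂ) ∂η := by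
    rw [integral_complex_ofReal, h.laplace _ (by positivity), one_mul,
      rpow_mul (by positivity), rpow_two]
  have hint : Integrable (uncurry fun (ξ : E n) (τ : ℝ) =>
      Complex.exp (((2 * π * inner ℝ ξ x : ℝ) : ℂ) * Complex.I) •
        ((exp (-((2 * π * ‖ξ‖) ^ 2 * τ)) : ℝ) : ℂ)) (volume.prod η) := by
    refine ((h.integrable_prod_exp_neg_sq_mul hs0).ofReal (𝕜 := ℂ)).swap.mono
      (Continuous.aestronglyMeasurable ?_) (.of_forall fun q => ?_)
    · simp only [uncurry_def]
      fun_prop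
    · simp only [uncurry_def, norm_smul, Complex.norm_exp_ofReal_mul_I, one_mul]
      exact le_rfl
  have hmixture : 𝓕⁻ (fun ξ : E n => ((exp (-(1 * (2 * π * ‖ξ‖) ^ (2 * s))) : ℝ) : ℂ)) x
      = ∫ τ, (gauss τ x : ℂ) ∂η := by
    simp_rw [hlaplace]
    rw [fourierInv_eq']
    simp_rw [← integral_smul]
    rw [integral_integral_swap hint]
    refine integral_congr_ae ?_
    filter_upwards [h.ae_pos] with τ hτ
    rw [← fourierInv_exp_neg_sq_mul hτ, fourierInv_eq']
  rw [kernel, hmixture, integral_complex_ofReal, Complex.ofReal_re, gaussMixture]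

end IsStableLaw

section Kernel

variable {n : ℕ} {s t : ℝ}

lemma kernel_eq_mul_kernel_one (hs0 : 0 < s) (ht : 0 < t) (x : E n) :
    kernel s t x = ((t ^ (1 / (2 * s))) ^ n)⁻¹ * kernel s 1 ((t ^ (1 / (2 * s)))⁻¹ • x) := by
  have hrt : (t ^ (1 / (2 * s))) ^ (2 * s) = t := by
    rw [← rpow_mul ht.le, one_div_mul_cancel (by positivity), rpow_one]
  set r := t ^ (1 / (2 * s))
  have hr : 0 < r := by positivity
  have hinner (ξ : E n) : inner ℝ (r • ξ) (r⁻¹ • x) = inner ℝ ξ x := by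
    rw [real_inner_smul_left, real_inner_smul_right, mul_inv_cancel_left₀ hr.ne']
  have hscale := Measure.integral_comp_smul (volume : Measure (E n))
    (fun ξ : E n => Complex.exp (((2 * π * inner ℝ ξ (r⁻¹ • x) : ℝ) : ℂ) * Complex.I) •
      ((exp (-(1 * symbol s ξ)) : ℝ) : ℂ)) r
  simp only [hinner, symbol_smul s hr.le, one_mul, hrt, finrank_euclideanSpace_fin,
    abs_of_pos (show 0 < (r ^ n)⁻¹ by positivity)] at hscale
  simp only [kernel, fourierInv_eq', one_mul, ← Complex.re_ofReal_mul]
  simp only [symbol] at hscale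
  rw [hscale, ← Complex.real_smul]

lemma kernel_pos (hs0 : 0 < s) (hs1 : s < 1) (ht : 0 < t) (x : E n) : 0 < kernel s t x := by
  obtain ⟨η, h⟩ := exists_isStableLaw hs0 hs1
  rw [kernel_eq_mul_kernel_one hs0 ht, h.kernel_one_eq_gaussMixture hs0]
  have := h.gaussMixture_pos hs0 hs1 ((t ^ (1 / (2 * s)))⁻¹ • x)
  positivity

variable (n) in
lemma exists_abs_kernel_taylor_le (hs0 : 0 < s) (hs1 : s < 1) :
    ∃ C : ℝ, 0 ≤ C ∧ ∀ t : ℝ, 0 < t → ∀ x y : E n, ‖y‖ ≤ t ^ (1 / (2 * s)) →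
      |kernel s t (x - y) - kernel s t x + fderiv ℝ (kernel s t) x y|
        ≤ C * (‖y‖ / t ^ (1 / (2 * s))) ^ 2 * kernel s t x := by
  obtain ⟨η, h⟩ := exists_isStableLaw hs0 hs1
  obtain ⟨C, hC, hle⟩ := h.exists_abs_gaussMixture_taylor_le (E n) hs0 hs1
  refine ⟨C, hC, fun t ht x y hy => ?_⟩
  have hscale : (kernel s t : E n → ℝ) = fun x =>
      ((t ^ (1 / (2 * s))) ^ n)⁻¹ * gaussMixture η ((t ^ (1 / (2 * s)))⁻¹ • x) :=
    funext fun x => by rw [kernel_eq_mul_kernel_one hs0 ht, h.kernel_one_eq_gaussMixture hs0]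
  set r := t ^ (1 / (2 * s))
  have hr : 0 < r := by positivity
  have hderiv : HasFDerivAt (kernel s t) ((r ^ n)⁻¹ •
      (-gaussMixtureSlope η (r⁻¹ • x) • innerSL ℝ (r⁻¹ • x)).comp
        (r⁻¹ • ContinuousLinearMap.id ℝ (E n))) x := by
    rw [hscale]
    exact ((h.hasFDerivAt_gaussMixture hs0 hs1 (r⁻¹ • x)).comp x
      ((hasFDerivAt_id x).const_smul r⁻¹)).const_mul _
  have hnorm : ‖r⁻¹ • y‖ = ‖y‖ / r := by
    rw [norm_smul, norm_of_nonneg (by positivity), div_eq_inv_mul]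
  have hmain := hle (r⁻¹ • x) (r⁻¹ • y) (by rw [hnorm]; exact div_le_one_of_le₀ hy hr.le)
  calc |kernel s t (x - y) - kernel s t x + fderiv ℝ (kernel s t) x y|
      = (r ^ n)⁻¹ * |gaussMixture η (r⁻¹ • x - r⁻¹ • y) - gaussMixture η (r⁻¹ • x)
          - gaussMixtureSlope η (r⁻¹ • x) * inner ℝ (r⁻¹ • x) (r⁻¹ • y)| := by
        rw [hderiv.fderiv, hscale, ← abs_of_pos (inv_pos.2 (pow_pos hr n)), ← abs_mul,
          abs_of_pos (inv_pos.2 (pow_pos hr n)), ← smul_sub]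
        congr 1
        simp only [smul_apply, ContinuousLinearMap.comp_apply, ContinuousLinearMap.id_apply,
          innerSL_apply_apply, smul_eq_mul]
        ring
    _ ≤ (r ^ n)⁻¹ * (C * ‖r⁻¹ • y‖ ^ 2 * gaussMixture η (r⁻¹ • x)) := by gcongr
    _ = _ := by
        rw [hscale, hnorm]
        ring

end Kernel

/-! ### The fractional Laplacian of truncated plane waves -/

section Multiplier

open scoped SchwartzMap ComplexConjugate

variable {V : Type*} [NormedAddCommGroup V] [InnerProductSpace ℝ V] [FiniteDimensional ℝ V]
  [MeasurableSpace V] [BorelSpace V] {s : ℝ}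

lemma integrable_exp_mul_I_mul {X : Type*} [MeasurableSpace X] [TopologicalSpace X]
    [OpensMeasurableSpace X] {μ : Measure X} {f : X → ℂ} (hf : Integrable f μ) {c : X → ℝ}
    (hc : Continuous c) : Integrable (fun v => Complex.exp ((c v : ℂ) * Complex.I) * f v) μ :=
  hf.bdd_mul (c := 1) (by fun_prop : Continuous _).aestronglyMeasurable
    (.of_forall fun v => (Complex.norm_exp_ofReal_mul_I _).le)

lemma fourier_conj (f : V → ℂ) (ξ : V) : 𝓕 (fun y => conj (f y)) ξ = conj (𝓕⁻ f ξ) := by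
  rw [fourier_eq', fourierInv_eq', ← integral_conj]
  congr 1; ext y
  simp [← Complex.exp_conj, Complex.conj_ofNat]

lemma fourierInv_conj (f : V → ℂ) (x : V) : 𝓕⁻ (fun ξ => conj (f ξ)) x = conj (𝓕 f x) := by
  simp [fourierInv_eq_fourier_neg, fourier_conj]

lemma integrable_conj {f : V → ℂ} (hf : Integrable f) : Integrable fun y => conj (f y) :=
  (Complex.conjLIE.toContinuousLinearEquiv.integrable_comp_iff).2 hf

lemma fourier_ofReal_re {f : V → ℂ} (hf : Integrable f) (ξ : V) :
    𝓕 (fun y => ((f y).re : ℂ)) ξ = 2⁻¹ * (𝓕 f ξ + conj (𝓕 f (-ξ))) := by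
  rw [← fourierInv_eq_fourier_neg, ← fourier_conj]
  simp only [fourier_eq', smul_eq_mul]
  rw [← integral_add (integrable_exp_mul_I_mul hf (by fun_prop))
    (integrable_exp_mul_I_mul (integrable_conj hf) (by fun_prop)), ← integral_const_mul]
  congr 1; ext y
  rw [Complex.re_eq_add_conj]
  ring

lemma exists_integrable_norm_symbol_mul_le (hs0 : 0 < s) (f : 𝓢(V, ℂ)) (ξ : V) :
    ∃ B : V → ℝ, Integrable B ∧ ∀ δ ∈ Icc (0 : ℝ) 1, ∀ η,
      ‖(symbol s (ξ + δ • η) : ℂ) * f η‖ ≤ B η := by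
  obtain ⟨C, k, hC⟩ := exists_symbol_add_smul_le hs0 ξ
  refine ⟨fun η => C * (‖f η‖ + ‖η‖ ^ k * ‖f η‖),
    (f.integrable.norm.add (f.integrable_pow_mul volume k)).const_mul C, fun δ hδ η => ?_⟩
  rw [norm_mul, Complex.norm_real, norm_of_nonneg (symbol_nonneg _ _)]
  calc symbol s (ξ + δ • η) * ‖f η‖ ≤ C * (1 + ‖η‖ ^ k) * ‖f η‖ := by
        gcongr
        exact hC δ hδ η
    _ = C * (‖f η‖ + ‖η‖ ^ k * ‖f η‖) := by ring

lemma integrable_symbol_mul (hs0 : 0 < s) (f : 𝓢(V, ℂ)) :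
    Integrable fun ξ => (symbol s ξ : ℂ) * f ξ := by
  obtain ⟨B, hB, hle⟩ := exists_integrable_norm_symbol_mul_le hs0 f 0
  have := continuous_symbol (V := V) hs0
  refine hB.mono' (by fun_prop : Continuous _).aestronglyMeasurable (.of_forall fun ξ => ?_)
  simpa using hle 1 (by simp) ξ

/-- The fractional Laplacian of a complex-valued function. -/
def complexFracLaplacian (s : ℝ) (g : V → ℂ) (x : V) : ℂ :=
  𝓕⁻ (fun ξ => (symbol s ξ : ℂ) * 𝓕 g ξ) x

lemma complexFracLaplacian_const_mul (s : ℝ) (c : ℂ) (g : V → ℂ) (x : V) :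
    complexFracLaplacian s (fun y => c * g y) x = c * complexFracLaplacian s g x := by
  simp only [complexFracLaplacian, fourier_eq', fourierInv_eq', smul_eq_mul, mul_left_comm _ c,
    integral_const_mul]

lemma continuous_complexFracLaplacian (hs0 : 0 < s) (g : 𝓢(V, ℂ)) :
    Continuous (complexFracLaplacian s g) := by
  have hint : Integrable fun ξ => (symbol s ξ : ℂ) * 𝓕 (g : V → ℂ) ξ :=
    integrable_symbol_mul hs0 (𝓕 g)
  exact ((continuous_fourier_of_integrable hint).comp continuous_neg).congr fun x =>
    (fourierInv_eq_fourier_neg _ x).symm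

lemma norm_complexFracLaplacian_le (s : ℝ) (g : V → ℂ) (x : V) :
    ‖complexFracLaplacian s g x‖ ≤ ∫ ξ, ‖(symbol s ξ : ℂ) * 𝓕 g ξ‖ := by
  rw [complexFracLaplacian, fourierInv_eq_fourier_neg]
  exact norm_fourier_le_integral_norm _ _

lemma complexFracLaplacian_re (hs0 : 0 < s) (g : 𝓢(V, ℂ)) (x : V) :
    complexFracLaplacian s (fun y => ((g y).re : ℂ)) x = (complexFracLaplacian s g x).re := by
  set m : V → ℂ := fun ξ => (symbol s ξ : ℂ) * 𝓕 (g : V → ℂ) ξ with hm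
  have hint : Integrable m := integrable_symbol_mul hs0 (𝓕 g)
  have hconj : 𝓕⁻ (fun ξ => conj (m (-ξ))) x = conj (𝓕⁻ m x) := by
    rw [fourierInv_conj, fourierInv_eq_fourier_comp_neg]
  calc complexFracLaplacian s (fun y => ((g y).re : ℂ)) x
      = 2⁻¹ * (𝓕⁻ m x + 𝓕⁻ (fun ξ => conj (m (-ξ))) x) := by
        simp only [complexFracLaplacian, fourierInv_eq', smul_eq_mul]
        rw [← integral_add (integrable_exp_mul_I_mul hint (by fun_prop))
          (integrable_exp_mul_I_mul (integrable_conj hint.comp_neg) (by fun_prop)),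
          ← integral_const_mul]
        congr 1; ext ξ
        simp only [hm, fourier_ofReal_re g.integrable, symbol, norm_neg, map_mul,
          Complex.conj_ofReal]
        ring
    _ = (complexFracLaplacian s g x).re := by
        rw [hconj, Complex.add_conj, complexFracLaplacian]
        push_cast
        ring

end Multiplier

open scoped SchwartzMap in
lemma fracLaplacian_const_mul_re {n : ℕ} {s : ℝ} (hs0 : 0 < s) (c : ℝ) (g : 𝓢(E n, ℂ)) (x : E n) :
    fracLaplacian s (fun y => c * (g y).re) x = c * (complexFracLaplacian s g x).re := by
  change (complexFracLaplacian s (fun y => ((c * (g y).re : ℝ) : ℂ)) x).re = _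
  simp only [Complex.ofReal_mul, complexFracLaplacian_const_mul, complexFracLaplacian_re hs0,
    Complex.re_ofReal_mul, Complex.ofReal_re]

section Wave

open scoped SchwartzMap

variable {V : Type*} [NormedAddCommGroup V] [InnerProductSpace ℝ V] {s δ : ℝ}

/-- The plane wave with frequency `ξ`, in the normalization of Mathlib's Fourier transform. -/
def planeWave (ξ x : V) : ℂ :=
  Complex.exp (((2 * π * inner ℝ x ξ : ℝ) : ℂ) * Complex.I)

lemma norm_planeWave (ξ x : V) : ‖planeWave ξ x‖ = 1 := Complex.norm_exp_ofReal_mul_I _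

lemma contDiff_planeWave (ξ : V) : ContDiff ℝ ∞ (planeWave ξ) := by
  have hinner : ContDiff ℝ ∞ fun x : V => (inner ℝ x ξ : ℝ) :=
    contDiff_id.inner ℝ contDiff_const
  have hphase : ContDiff ℝ ∞ fun x : V => ((2 * π * inner ℝ x ξ : ℝ) : ℂ) :=
    Complex.ofRealCLM.contDiff.comp (contDiff_const.mul hinner)
  exact (hphase.mul contDiff_const).cexp

/-- The plane wave with frequency `ξ`, truncated by a cutoff `χ` at scale `δ⁻¹`. -/
def wave (χ : V → ℂ) (δ : ℝ) (ξ x : V) : ℂ :=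
  planeWave ξ x * χ (δ • x)

lemma contDiff_wave {χ : V → ℂ} (hχ : ContDiff ℝ ∞ χ) (δ : ℝ) (ξ : V) :
    ContDiff ℝ ∞ (wave χ δ ξ) :=
  (contDiff_planeWave ξ).mul (hχ.comp (contDiff_const_smul δ))

lemma hasCompactSupport_wave {χ : V → ℂ} (hχ : HasCompactSupport χ) (hδ : δ ≠ 0) (ξ : V) :
    HasCompactSupport (wave χ δ ξ) :=
  (hχ.comp_homeomorph (Homeomorph.smulOfNeZero δ hδ)).mul_left

lemma norm_wave (χ : V → ℂ) (δ : ℝ) (ξ x : V) : ‖wave χ δ ξ x‖ = ‖χ (δ • x)‖ := by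
  rw [wave, norm_mul, norm_planeWave, one_mul]

lemma tendsto_wave {χ : V → ℂ} (hχ : Continuous χ) (ξ x : V) :
    Tendsto (fun δ => wave χ δ ξ x) (𝓝 0) (𝓝 (planeWave ξ x * χ 0)) := by
  have hc : Continuous fun δ => wave χ δ ξ x := by unfold wave; fun_prop
  simpa [wave] using hc.tendsto 0

variable [FiniteDimensional ℝ V] [MeasurableSpace V] [BorelSpace V]

lemma fourier_wave (χ : V → ℂ) (hδ : 0 < δ) (ξ₀ ξ : V) :
    𝓕 (wave χ δ ξ₀) ξ = ((δ ^ finrank ℝ V)⁻¹ : ℝ) * 𝓕 χ (δ⁻¹ • (ξ - ξ₀)) := by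
  have hscale := Measure.integral_comp_smul (volume : Measure V) (fun w : V =>
    Complex.exp (((-2 * π * inner ℝ w (δ⁻¹ • (ξ - ξ₀)) : ℝ) : ℂ) * Complex.I) • χ w) δ
  rw [abs_of_pos (by positivity), ← fourier_eq', Complex.real_smul] at hscale
  rw [← hscale, fourier_eq']
  congr 1; ext y
  rw [wave, planeWave, smul_eq_mul, smul_eq_mul, ← mul_assoc, ← Complex.exp_add,
    real_inner_smul_left, real_inner_smul_right, mul_inv_cancel_left₀ hδ.ne', inner_sub_right]
  congr 2
  push_cast
  ring

/-- The fractional Laplacian of the truncated plane wave `wave χ δ ξ` for `0 < δ`, in a form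
that is suited to the limit `δ → 0`. -/
def waveLaplacian (χ : V → ℂ) (s δ : ℝ) (ξ x : V) : ℂ :=
  ∫ η, Complex.exp (((2 * π * inner ℝ (ξ + δ • η) x : ℝ) : ℂ) * Complex.I)
    * ((symbol s (ξ + δ • η) : ℂ) * 𝓕 χ η)

lemma complexFracLaplacian_wave (χ : V → ℂ) (s : ℝ) (hδ : 0 < δ) (ξ₀ x : V) :
    complexFracLaplacian s (wave χ δ ξ₀) x = waveLaplacian χ s δ ξ₀ x := by
  set G : V → ℂ := fun ξ => Complex.exp (((2 * π * inner ℝ ξ x : ℝ) : ℂ) * Complex.I)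
    * ((symbol s ξ : ℂ) * 𝓕 χ (δ⁻¹ • (ξ - ξ₀))) with hG
  have hscale := Measure.integral_comp_smul (volume : Measure V) (fun w => G (ξ₀ + w)) δ
  rw [integral_add_left_eq_self G ξ₀, abs_of_pos (by positivity), Complex.real_smul,
    ← integral_const_mul] at hscale
  simp only [hG, add_sub_cancel_left, inv_smul_smul₀ hδ.ne'] at hscale
  rw [complexFracLaplacian, waveLaplacian, hscale, fourierInv_eq']
  congr 1; ext ξ
  rw [fourier_wave χ hδ, smul_eq_mul]
  ring

lemma exists_norm_waveLaplacian_le (hs0 : 0 < s) (χ : 𝓢(V, ℂ)) (ξ : V) :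
    ∃ C, ∀ δ ∈ Icc (0 : ℝ) 1, ∀ x, ‖waveLaplacian χ s δ ξ x‖ ≤ C := by
  obtain ⟨B, hB, hle⟩ := exists_integrable_norm_symbol_mul_le hs0 (𝓕 χ) ξ
  refine ⟨∫ η, B η, fun δ hδ x => norm_integral_le_of_norm_le hB (.of_forall fun η => ?_)⟩
  rw [norm_mul, Complex.norm_exp_ofReal_mul_I, one_mul]
  exact hle δ hδ η

lemma tendsto_waveLaplacian (hs0 : 0 < s) (χ : 𝓢(V, ℂ)) (ξ x : V) :
    Tendsto (fun δ => waveLaplacian χ s δ ξ x) (𝓝[>] 0)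
      (𝓝 (symbol s ξ * (planeWave ξ x * χ 0))) := by
  obtain ⟨B, hB, hle⟩ := exists_integrable_norm_symbol_mul_le hs0 (𝓕 χ) ξ
  have hsym := continuous_symbol (V := V) hs0
  have hhat : Continuous (𝓕 (χ : V → ℂ)) := continuous_fourier_of_integrable χ.integrable
  have hlim : Tendsto (fun δ => waveLaplacian χ s δ ξ x) (𝓝[>] 0) (𝓝 (∫ η,
      Complex.exp (((2 * π * inner ℝ ξ x : ℝ) : ℂ) * Complex.I) * ((symbol s ξ : ℂ) *
        𝓕 (χ : V → ℂ) η))) := by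
    refine tendsto_integral_filter_of_dominated_convergence B
      (.of_forall fun δ => (by fun_prop : Continuous _).aestronglyMeasurable) ?_ hB
      (.of_forall fun η => ?_)
    · filter_upwards [Ioc_mem_nhdsGT one_pos] with δ hδ
      refine .of_forall fun η => ?_
      rw [norm_mul, Complex.norm_exp_ofReal_mul_I, one_mul]
      exact hle δ (Ioc_subset_Icc_self hδ) η
    · have hc : Continuous fun δ : ℝ =>
          Complex.exp (((2 * π * inner ℝ (ξ + δ • η) x : ℝ) : ℂ) * Complex.I)
            * ((symbol s (ξ + δ • η) : ℂ) * 𝓕 (χ : V → ℂ) η) := by fun_prop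
      simpa using (hc.tendsto 0).mono_left nhdsWithin_le_nhds
  have hinv : ∫ η, 𝓕 (χ : V → ℂ) η = χ 0 := by
    have h := congrFun (χ.continuous.fourierInv_fourier_eq χ.integrable (𝓕 χ).integrable) 0
    simpa [fourierInv_eq'] using h
  rw [integral_const_mul, integral_const_mul, hinv, real_inner_comm] at hlim
  convert hlim using 2
  rw [planeWave]
  ring

end Wave

/-! ### Weak linear ordinary differential equations -/

lemma contDiff_intervalIntegral {ψ : ℝ → ℝ} (hψ : ContDiff ℝ ∞ ψ) (a : ℝ) :
    ContDiff ℝ ∞ fun t => ∫ r in a..t, ψ r := by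
  have hderiv : ∀ t, HasDerivAt (fun t => ∫ r in a..t, ψ r) (ψ t) t := fun t =>
    hψ.continuous.integral_hasStrictDerivAt a t |>.hasDerivAt
  refine contDiff_infty_iff_deriv.2 ⟨fun t => (hderiv t).differentiableAt, ?_⟩
  rwa [funext fun t => (hderiv t).deriv]

lemma exists_pos_forall_le_eq_zero {M : Type*} [Zero M] {ψ : ℝ → M} (hψ : HasCompactSupport ψ) :
    ∃ T, 0 < T ∧ ∀ t, T ≤ t → ψ t = 0 := by
  obtain ⟨r, hr, hsub⟩ := hψ.isCompact.isBounded.subset_ball_lt 0 0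
  refine ⟨r, hr, fun t ht => image_eq_zero_of_notMem_tsupport fun hmem => ?_⟩
  have hlt := hsub hmem
  rw [Metric.mem_ball, dist_zero_right, norm_eq_abs] at hlt
  linarith [le_abs_self t]

lemma exists_hasCompactSupport_deriv_eq {ψ : ℝ → ℝ} (hψ : ContDiff ℝ ∞ ψ)
    (hψc : HasCompactSupport ψ) : ∃ φ : ℝ → ℝ, ContDiff ℝ ∞ φ ∧ HasCompactSupport φ ∧
      (∀ t, 0 < t → deriv φ t = ψ t) ∧ φ 0 = -∫ t in Ioi 0, ψ t := by
  obtain ⟨T, hT0, hT⟩ := exists_pos_forall_le_eq_zero hψc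
  set κ : ℝ → ℝ := fun t => smoothTransition (t + 2)
  have hκ_one : ∀ t, -1 ≤ t → κ t = 1 := fun t ht => smoothTransition.one_of_one_le (by linarith)
  have hκ_zero : ∀ t, t ≤ -2 → κ t = 0 := fun t ht =>
    smoothTransition.zero_of_nonpos (by linarith)
  have hκ_smooth : ContDiff ℝ ∞ κ := smoothTransition.contDiff.comp (by fun_prop)
  set I : ℝ → ℝ := fun t => ∫ r in T..t, ψ r with hI
  have hI_zero : ∀ t, T ≤ t → I t = 0 := fun t ht => by
    refine intervalIntegral.integral_zero_ae (.of_forall fun r hr => hT r ?_)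
    rw [uIoc_of_le ht] at hr
    exact hr.1.le
  refine ⟨fun t => κ t * I t, hκ_smooth.mul (contDiff_intervalIntegral hψ T), ?_,
    fun t ht => ?_, ?_⟩
  · refine HasCompactSupport.intro (isCompact_Icc (a := -2) (b := T)) fun t ht => ?_
    rcases lt_or_ge t (-2) with h | h
    · rw [hκ_zero t h.le, zero_mul]
    · rw [hI_zero t (not_le.1 fun hle => ht ⟨h, hle⟩).le, mul_zero]
  · have hloc : (fun t => κ t * I t) =ᶠ[𝓝 t] I := by
      filter_upwards [lt_mem_nhds ht] with r hr
      rw [hκ_one r (by linarith), one_mul]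
    rw [hloc.deriv_eq, hI, hψ.continuous.deriv_integral]
  · dsimp only
    rw [hκ_one 0 (by norm_num), one_mul]
    simp only [hI]
    rw [intervalIntegral.integral_symm, intervalIntegral.integral_of_le hT0.le,
      setIntegral_eq_of_subset_of_forall_sdiff_eq_zero measurableSet_Ioi Ioc_subset_Ioi_self]
    exact fun r hr => hT r (not_le.1 fun hle => hr.2 ⟨hr.1, hle⟩).le

lemma exists_hasCompactSupport_deriv_sub_eq (m : ℝ) {ψ : ℝ → ℝ} (hψ : ContDiff ℝ ∞ ψ)
    (hψc : HasCompactSupport ψ) : ∃ θ : ℝ → ℝ, ContDiff ℝ ∞ θ ∧ HasCompactSupport θ ∧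
      (∀ t, 0 < t → deriv θ t - m * θ t = ψ t) ∧
      θ 0 = -∫ t in Ioi 0, ψ t * exp (-(m * t)) := by
  obtain ⟨φ, hφ, hφc, hφ_deriv, hφ_zero⟩ := exists_hasCompactSupport_deriv_eq
    (ψ := fun t => ψ t * exp (-(m * t))) (by fun_prop) hψc.mul_right
  refine ⟨fun t => exp (m * t) * φ t, by fun_prop, hφc.mul_left, fun t ht => ?_, by simp [hφ_zero]⟩
  have hexp : HasDerivAt (fun t => exp (m * t)) (exp (m * t) * (m * 1)) t :=
    ((hasDerivAt_id t).const_mul m).exp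
  have hφt : HasDerivAt φ (ψ t * exp (-(m * t))) t :=
    hφ_deriv t ht ▸ (hφ.differentiable (by simp) t).hasDerivAt
  have hmul : HasDerivAt (fun t => exp (m * t) * φ t) _ t := hexp.mul hφt
  rw [hmul.deriv, exp_neg]
  field_simp
  ring

lemma ae_eq_exp_smul_of_weak {F : Type*} [NormedAddCommGroup F] [NormedSpace ℝ F]
    [CompleteSpace F] {m : ℝ} {W : ℝ → F} {W₀ : F} (hW : LocallyIntegrableOn W (Ioi 0))
    (h : ∀ θ : ℝ → ℝ, ContDiff ℝ ∞ θ → HasCompactSupport θ →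
      (∫ t in Ioi 0, (deriv θ t - m * θ t) • W t) + θ 0 • W₀ = 0) :
    ∀ᵐ t : ℝ, 0 < t → W t = exp (-(m * t)) • W₀ := by
  have hexp : Continuous fun t : ℝ => exp (-(m * t)) • W₀ := by fun_prop
  have hzero : ∀ᵐ t : ℝ, t ∈ Ioi 0 → W t - exp (-(m * t)) • W₀ = 0 := by
    refine isOpen_Ioi.ae_eq_zero_of_integral_contDiff_smul_eq_zero
      (hW.sub (hexp.locallyIntegrable.locallyIntegrableOn _)) fun ψ hψ hψc hsupp => ?_
    obtain ⟨θ, hθ, hθc, hθ_deriv, hθ_zero⟩ := exists_hasCompactSupport_deriv_sub_eq m hψ hψc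
    have hψW : IntegrableOn (fun t => ψ t • W t) (Ioi 0) :=
      ((integrableOn_iff_integrable_of_support_subset
        ((support_smul_subset_left _ _).trans (subset_tsupport ψ))).1
        (((hW.mono_set hsupp).integrableOn_isCompact hψc.isCompact).continuousOn_smul
          hψ.continuous.continuousOn hψc.isCompact)).integrableOn
    have hψexp : IntegrableOn (fun t => ψ t • exp (-(m * t)) • W₀) (Ioi 0) :=
      (Continuous.integrable_of_hasCompactSupport (by have := hψ.continuous; fun_prop)
        hψc.smul_right).integrableOn
    have hweak : ∫ t in Ioi 0, ψ t • W t = ∫ t in Ioi 0, ψ t • exp (-(m * t)) • W₀ := by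
      have h := h θ hθ hθc
      rw [setIntegral_congr_fun measurableSet_Ioi fun t ht => by
        rw [hθ_deriv t ht], hθ_zero, neg_smul, ← integral_smul_const, add_neg_eq_zero] at h
      simpa only [smul_smul] using h
    rw [← setIntegral_eq_integral_of_forall_compl_eq_zero fun t ht => by
        rw [image_eq_zero_of_notMem_tsupport fun hmem => ht (hsupp hmem), zero_smul]]
    simp only [smul_sub]
    rw [integral_sub hψW hψexp, hweak, sub_self]
  filter_upwards [hzero] with t ht ht0 using sub_eq_zero.1 (ht ht0)

/-! ### Fourier modes of weak solutions -/

lemma tendsto_integral_mul_of_norm_le {ι X : Type*} [MeasurableSpace X] {μ : Measure X}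
    {l : Filter ι} [l.IsCountablyGenerated] {f g : X → ℂ} {G : ι → X → ℂ} {C : ℝ}
    (hf : Integrable f μ) (hG : ∀ᶠ i in l, AEStronglyMeasurable (G i) μ)
    (hle : ∀ᶠ i in l, ∀ x, ‖G i x‖ ≤ C) (hlim : ∀ x, Tendsto (fun i => G i x) l (𝓝 (g x))) :
    Tendsto (fun i => ∫ x, f x * G i x ∂μ) l (𝓝 (∫ x, f x * g x ∂μ)) := by
  refine tendsto_integral_filter_of_dominated_convergence (fun x => ‖f x‖ * C) ?_ ?_
    (hf.norm.mul_const C) (.of_forall fun x => (hlim x).const_mul (f x))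
  · filter_upwards [hG] with i hi using hf.aestronglyMeasurable.mul hi
  · filter_upwards [hle] with i hi
    refine .of_forall fun x => ?_
    rw [norm_mul]
    gcongr
    exact hi x

lemma hasCompactSupport_mul_prod {X Y M : Type*} [TopologicalSpace X] [TopologicalSpace Y]
    [R1Space X] [R1Space Y] [MulZeroClass M] {f : X → M} {g : Y → M} (hf : HasCompactSupport f)
    (hg : HasCompactSupport g) : HasCompactSupport fun q : X × Y => f q.1 * g q.2 := by
  refine .intro (hf.isCompact.prod hg.isCompact) fun q hq => ?_
  rcases not_and_or.1 (mem_prod.not.1 hq) with h | h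
  · rw [image_eq_zero_of_notMem_tsupport h, zero_mul]
  · rw [image_eq_zero_of_notMem_tsupport h, mul_zero]

/-- Lebesgue measure on `(0,∞) × ℝⁿ`. -/
def spaceTime (n : ℕ) : Measure (ℝ × E n) := (volume.restrict (Ioi 0)).prod volume

lemma integral_spaceTime {n : ℕ} {F : Type*} [NormedAddCommGroup F] [NormedSpace ℝ F]
    {f : ℝ × E n → F} (hf : Integrable f (spaceTime n)) :
    ∫ q, f q ∂spaceTime n = ∫ t in Ioi 0, ∫ x, f (t, x) :=
  integral_prod _ hf

/-- The integral of `u` over `(0,∞) × ℝⁿ` against the product test function `θ(t) g(x)`. -/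
def pairing {n : ℕ} (u : ℝ → E n → ℝ) (θ : ℝ → ℝ) (g : E n → ℂ) : ℂ :=
  ∫ q, ((θ q.1 * u q.1 q.2 : ℝ) : ℂ) * g q.2 ∂spaceTime n

lemma pairing_const_mul {n : ℕ} (u : ℝ → E n → ℝ) (θ : ℝ → ℝ) (c : ℂ) (g : E n → ℂ) :
    pairing u θ (fun x => c * g x) = c * pairing u θ g := by
  simp only [pairing, mul_left_comm _ c, integral_const_mul]

open scoped SchwartzMap in
lemma exists_schwartz_hasCompactSupport_apply_zero_eq_one (V : Type*) [NormedAddCommGroup V]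
    [InnerProductSpace ℝ V] [FiniteDimensional ℝ V] :
    ∃ χ : 𝓢(V, ℂ), HasCompactSupport χ ∧ χ 0 = 1 := by
  let bump : ContDiffBump (0 : V) := ⟨1, 2, one_pos, one_lt_two⟩
  have hsupp : HasCompactSupport fun x => (bump x : ℂ) :=
    bump.hasCompactSupport.comp_left Complex.ofReal_zero
  refine ⟨hsupp.toSchwartzMap (Complex.ofRealCLM.contDiff.comp bump.contDiff), hsupp, ?_⟩
  exact congrArg Complex.ofReal (bump.one_of_mem_closedBall (by simp [bump]))

namespace IsWeakSolution

open scoped SchwartzMap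

variable {n : ℕ} {s : ℝ} {u₀ : E n → ℝ} {u : ℝ → E n → ℝ} {θ : ℝ → ℝ} {g : E n → ℂ} {C : ℝ}

lemma integrable_mul (hu : IsWeakSolution s u₀ u) (hθ : Continuous θ)
    (hθc : HasCompactSupport θ) :
    Integrable (fun q : ℝ × E n => θ q.1 * u q.1 q.2) (spaceTime n) := by
  obtain ⟨T, hT0, hT⟩ := exists_pos_forall_le_eq_zero hθc
  obtain ⟨C, hC⟩ := hθc.exists_bound_of_continuous hθ
  have hIoo : IntegrableOn (fun q : ℝ × E n => θ q.1 * u q.1 q.2) (Ioo 0 T ×ˢ univ) :=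
    (hu.integrableOn T hT0).bdd_mul (by fun_prop : Continuous _).aestronglyMeasurable
      (.of_forall fun q => hC q.1)
  have hIoi : IntegrableOn (fun q : ℝ × E n => θ q.1 * u q.1 q.2) (Ioi 0 ×ˢ univ) := by
    refine hIoo.of_forall_sdiff_eq_zero (measurableSet_Ioi.prod .univ) fun q hq => ?_
    rw [hT q.1 (not_lt.1 fun hlt => hq.2 ⟨⟨hq.1.1, hlt⟩, hq.1.2⟩), zero_mul]
  rwa [IntegrableOn, Measure.volume_eq_prod, ← Measure.prod_restrict, Measure.restrict_univ]
    at hIoi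

lemma integrable_mul_mul (hu : IsWeakSolution s u₀ u) (hθ : Continuous θ)
    (hθc : HasCompactSupport θ) (hg : Continuous g) (hle : ∀ x, ‖g x‖ ≤ C) :
    Integrable (fun q : ℝ × E n => ((θ q.1 * u q.1 q.2 : ℝ) : ℂ) * g q.2) (spaceTime n) :=
  (hu.integrable_mul hθ hθc).ofReal.mul_bdd (c := C)
    (by fun_prop : Continuous _).aestronglyMeasurable (.of_forall fun q => hle q.2)

lemma integrable_mul_mul_re (hu : IsWeakSolution s u₀ u) (hθ : Continuous θ)
    (hθc : HasCompactSupport θ) (hg : Continuous g) (hle : ∀ x, ‖g x‖ ≤ C) :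
    Integrable (fun q : ℝ × E n => θ q.1 * u q.1 q.2 * (g q.2).re) (spaceTime n) := by
  simpa only [RCLike.re_to_complex, Complex.re_ofReal_mul]
    using (hu.integrable_mul_mul hθ hθc hg hle).re

lemma pairing_re (hu : IsWeakSolution s u₀ u) (hθ : Continuous θ) (hθc : HasCompactSupport θ)
    (hg : Continuous g) (hle : ∀ x, ‖g x‖ ≤ C) :
    (pairing u θ g).re = ∫ q, θ q.1 * u q.1 q.2 * (g q.2).re ∂spaceTime n := by
  have h := integral_re (hu.integrable_mul_mul hθ hθc hg hle)
  simp only [RCLike.re_to_complex, Complex.re_ofReal_mul] at h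
  exact h.symm

lemma re_weak (hu : IsWeakSolution s u₀ u) (hs0 : 0 < s) (hu₀ : Integrable u₀)
    (hθ : ContDiff ℝ ∞ θ) (hθc : HasCompactSupport θ) (g : 𝓢(E n, ℂ)) (hg : HasCompactSupport g) :
    (pairing u (deriv θ) g - pairing u θ (complexFracLaplacian s g)
      + θ 0 * ∫ x, (u₀ x : ℂ) * g x).re = 0 := by
  obtain ⟨C, hC⟩ := hg.exists_bound_of_continuous g.continuous
  have hL := continuous_complexFracLaplacian hs0 g
  have hL_le := norm_complexFracLaplacian_le s g
  have hθ' : Continuous (deriv θ) := hθ.continuous_deriv (by simp)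
  have hre' := hu.integrable_mul_mul_re hθ' hθc.deriv g.continuous hC
  have hre := hu.integrable_mul_mul_re hθ.continuous hθc hL hL_le
  have hbulk : ∫ t in Ioi 0, ∫ x, u t x * (deriv θ t * (g x).re
      - θ t * (complexFracLaplacian s g x).re)
      = (pairing u (deriv θ) g).re - (pairing u θ (complexFracLaplacian s g)).re := by
    rw [hu.pairing_re hθ' hθc.deriv g.continuous hC, hu.pairing_re hθ.continuous hθc hL hL_le,
      ← integral_sub hre' hre]
    refine Eq.trans ?_ (integral_spaceTime (hre'.sub hre)).symm
    congr 1; ext t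
    congr 1; ext x
    simp only [Pi.sub_apply]
    ring
  have hinit : ∫ x, u₀ x * (θ 0 * (g x).re) = θ 0 * (∫ x, (u₀ x : ℂ) * g x).re := by
    have h := integral_re
      ((hu₀.ofReal (𝕜 := ℂ)).mul_bdd g.continuous.aestronglyMeasurable (.of_forall hC))
    simp only [RCLike.re_to_complex, RCLike.ofReal_eq_complex_ofReal, Complex.re_ofReal_mul] at h
    rw [← h, ← integral_const_mul]
    simp only [mul_left_comm]
  have hsmooth : ContDiff ℝ ∞ fun q : ℝ × E n => θ q.1 * (g q.2).re :=
    (hθ.comp contDiff_fst).mul (Complex.reCLM.contDiff.comp (g.smooth'.comp contDiff_snd))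
  have hg_re : HasCompactSupport fun x => (g x).re := hg.comp_left (g := Complex.re) rfl
  have hsupp : HasCompactSupport fun q : ℝ × E n => θ q.1 * (g q.2).re :=
    hasCompactSupport_mul_prod (f := θ) (g := fun x => (g x).re) hθc hg_re
  have hweak := hu.weak _ hsmooth hsupp
  simp only [deriv_mul_const_field, fracLaplacian_const_mul_re hs0] at hweak
  rw [Complex.add_re, Complex.sub_re, Complex.re_ofReal_mul, ← hbulk, ← hinit, hweak]

lemma weak_schwartz (hu : IsWeakSolution s u₀ u) (hs0 : 0 < s) (hu₀ : Integrable u₀)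
    (hθ : ContDiff ℝ ∞ θ) (hθc : HasCompactSupport θ) (g : 𝓢(E n, ℂ)) (hg : HasCompactSupport g) :
    pairing u (deriv θ) g - pairing u θ (complexFracLaplacian s g)
      + θ 0 * ∫ x, (u₀ x : ℂ) * g x = 0 := by
  refine Complex.ext (hu.re_weak hs0 hu₀ hθ hθc g hg) ?_
  have him := hu.re_weak hs0 hu₀ hθ hθc (-Complex.I • g) (hg.smul_left (f := fun _ => -Complex.I))
  have hsmul : ⇑(-Complex.I • g) = fun x => -Complex.I * g x := rfl
  simp only [hsmul, funext (complexFracLaplacian_const_mul s _ _), pairing_const_mul,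
    mul_left_comm _ (-Complex.I), integral_const_mul] at him
  rw [← mul_sub, ← mul_add] at him
  simpa using him

lemma tendsto_pairing {ι : Type*} {l : Filter ι} [l.IsCountablyGenerated]
    (hu : IsWeakSolution s u₀ u) (hθ : Continuous θ) (hθc : HasCompactSupport θ)
    {G : ι → E n → ℂ} (hG : ∀ᶠ i in l, Continuous (G i)) (hle : ∀ᶠ i in l, ∀ x, ‖G i x‖ ≤ C)
    (hlim : ∀ x, Tendsto (fun i => G i x) l (𝓝 (g x))) :
    Tendsto (fun i => pairing u θ (G i)) l (𝓝 (pairing u θ g)) := by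
  refine tendsto_integral_mul_of_norm_le (C := C) (hu.integrable_mul hθ hθc).ofReal ?_ ?_
    fun q => hlim q.2
  · filter_upwards [hG] with i hi
    exact (hi.comp continuous_snd).aestronglyMeasurable
  · filter_upwards [hle] with i hi q using hi q.2

lemma weak_planeWave (hu : IsWeakSolution s u₀ u) (hs0 : 0 < s) (hu₀ : Integrable u₀)
    (hθ : ContDiff ℝ ∞ θ) (hθc : HasCompactSupport θ) (ξ : E n) :
    pairing u (deriv θ) (planeWave ξ) - symbol s ξ * pairing u θ (planeWave ξ)
      + θ 0 * ∫ x, (u₀ x : ℂ) * planeWave ξ x = 0 := by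
  obtain ⟨χ, hχ_supp, hχ_zero⟩ := exists_schwartz_hasCompactSupport_apply_zero_eq_one (E n)
  obtain ⟨B, hB⟩ := hχ_supp.exists_bound_of_continuous χ.continuous
  obtain ⟨C, hC⟩ := exists_norm_waveLaplacian_le hs0 χ ξ
  have hcpt : ∀ {δ : ℝ}, 0 < δ → HasCompactSupport (wave χ δ ξ) := fun hδ =>
    hasCompactSupport_wave hχ_supp hδ.ne' ξ
  let W {δ : ℝ} (hδ : 0 < δ) : 𝓢(E n, ℂ) := (hcpt hδ).toSchwartzMap (contDiff_wave χ.smooth' δ ξ)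
  have hpos : ∀ᶠ δ : ℝ in 𝓝[>] 0, 0 < δ := self_mem_nhdsWithin
  have hcont : ∀ᶠ δ in 𝓝[>] 0, Continuous (wave χ δ ξ) :=
    .of_forall fun δ => (contDiff_wave χ.smooth' δ ξ).continuous
  have hbound : ∀ᶠ δ in 𝓝[>] 0, ∀ x, ‖wave χ δ ξ x‖ ≤ B :=
    .of_forall fun δ x => (norm_wave χ δ ξ x).trans_le (hB _)
  have hwave : ∀ x, Tendsto (fun δ => wave χ δ ξ x) (𝓝[>] 0) (𝓝 (planeWave ξ x)) := fun x => by
    simpa [hχ_zero] using (tendsto_wave χ.continuous ξ x).mono_left nhdsWithin_le_nhds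
  have hlap : ∀ x, Tendsto (fun δ => complexFracLaplacian s (wave χ δ ξ) x) (𝓝[>] 0)
      (𝓝 (symbol s ξ * planeWave ξ x)) := fun x => by
    have h := tendsto_waveLaplacian hs0 χ ξ x
    rw [hχ_zero, mul_one] at h
    refine h.congr' ?_
    filter_upwards [hpos] with δ hδ using (complexFracLaplacian_wave χ s hδ ξ x).symm
  have hlim := ((hu.tendsto_pairing (hθ.continuous_deriv (by simp)) hθc.deriv hcont hbound
    hwave).sub (hu.tendsto_pairing (C := C) hθ.continuous hθc ?_ ?_ hlap)).add
    ((tendsto_integral_mul_of_norm_le hu₀.ofReal ?_ hbound hwave).const_mul (θ 0 : ℂ))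
  · rw [pairing_const_mul] at hlim
    refine tendsto_nhds_unique (hlim.congr' ?_) tendsto_const_nhds
    filter_upwards [hpos] with δ hδ using hu.weak_schwartz hs0 hu₀ hθ hθc (W hδ) (hcpt hδ)
  · filter_upwards [hpos] with δ hδ using continuous_complexFracLaplacian hs0 (W hδ)
  · filter_upwards [Ioc_mem_nhdsGT one_pos] with δ hδ x
    rw [complexFracLaplacian_wave χ s hδ.1]
    exact hC δ (Ioc_subset_Icc_self hδ) x
  · filter_upwards [hcont] with δ hδ using hδ.aestronglyMeasurable

end IsWeakSolution

/-! ### Weak solutions as convolutions with the kernel -/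

section Spectral

variable {V : Type*} [NormedAddCommGroup V] [InnerProductSpace ℝ V] [FiniteDimensional ℝ V]
  [MeasurableSpace V] [BorelSpace V] {s t : ℝ} {f m : V → ℂ}

lemma fourierInv_eq_integral_mul_planeWave (f : V → ℂ) (ξ : V) :
    𝓕⁻ f ξ = ∫ x, f x * planeWave ξ x := by
  simp only [fourierInv_eq', planeWave, smul_eq_mul, mul_comm]

lemma integrable_fourierInv_sub_mul (hm : Integrable m) (hf : Integrable f) (x : V) :
    Integrable fun y => 𝓕⁻ m (x - y) * f y := by
  have hhat := continuous_fourier_of_integrable hm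
  simp only [fourierInv_eq_fourier_neg]
  exact hf.bdd_mul (by fun_prop : Continuous _).aestronglyMeasurable
    (.of_forall fun y => norm_fourier_le_integral_norm m _)

lemma fourierInv_mul_fourier (hm : Integrable m) (hf : Integrable f) (x : V) :
    𝓕⁻ (fun ξ => m ξ * 𝓕 f ξ) x = ∫ y, 𝓕⁻ m (x - y) * f y := by
  set mx : V → ℂ := fun ξ => Complex.exp (((2 * π * inner ℝ ξ x : ℝ) : ℂ) * Complex.I) * m ξ
    with hmx
  have hshift (y : V) : 𝓕 mx y = 𝓕⁻ m (x - y) := by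
    rw [fourier_eq', fourierInv_eq']
    congr 1; ext ξ
    rw [hmx, smul_eq_mul, smul_eq_mul, ← mul_assoc, ← Complex.exp_add, inner_sub_right]
    congr 2
    push_cast
    ring
  have hflip : ∫ y, 𝓕 mx y * f y = ∫ ξ, mx ξ * 𝓕 f ξ := by
    simpa using! VectorFourier.integral_fourierIntegral_smul_eq_flip (L := innerₗ V)
      continuous_fourierChar continuous_inner (integrable_exp_mul_I_mul hm (by fun_prop)) hf
  simp only [hshift] at hflip
  rw [hflip, fourierInv_eq']
  simp only [hmx, smul_eq_mul, mul_assoc]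

/-- The solution of the fractional heat equation at time `t`, in terms of the Fourier transform of
its initial datum `f`. -/
def spectralSolution (s : ℝ) (f : V → ℂ) (t : ℝ) (x : V) : ℂ :=
  𝓕⁻ (fun ξ => ((exp (-(t * symbol s ξ)) : ℝ) : ℂ) * 𝓕 f ξ) x

lemma integrable_exp_neg_mul_fourier (hs0 : 0 < s) (hf : Integrable f) (ht : 0 < t) :
    Integrable fun ξ => ((exp (-(t * symbol s ξ)) : ℝ) : ℂ) * 𝓕 f ξ :=
  (integrable_exp_neg_mul_symbol hs0 ht).ofReal.mul_bdd
    (continuous_fourier_of_integrable hf).aestronglyMeasurable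
    (.of_forall (norm_fourier_le_integral_norm f))

lemma continuousOn_spectralSolution (hs0 : 0 < s) (hf : Integrable f) (x : V) :
    ContinuousOn (fun t => spectralSolution s f t x) (Ioi 0) := by
  refine fun t₀ (ht₀ : 0 < t₀) => ContinuousAt.continuousWithinAt ?_
  have hhat := continuous_fourier_of_integrable hf
  have hsym := continuous_symbol (V := V) hs0
  simp only [spectralSolution, fourierInv_eq', smul_eq_mul]
  refine continuousAt_of_dominated (bound := fun ξ =>
    ‖((exp (-(t₀ / 2 * symbol s ξ)) : ℝ) : ℂ) * 𝓕 f ξ‖)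
    (.of_forall fun t => (by fun_prop : Continuous _).aestronglyMeasurable) ?_
    (integrable_exp_neg_mul_fourier hs0 hf (half_pos ht₀)).norm
    (.of_forall fun ξ => by fun_prop)
  filter_upwards [lt_mem_nhds (half_lt_self ht₀)] with t ht
  refine .of_forall fun ξ => ?_
  have := symbol_nonneg s ξ
  simp only [norm_mul, Complex.norm_exp_ofReal_mul_I, one_mul, Complex.norm_real, norm_eq_abs,
    abs_exp]
  gcongr

end Spectral

section Kernel

variable {n : ℕ} {s t : ℝ} {u₀ : E n → ℝ}

lemma re_fourierInv_mul_eq_kernel_mul (s t : ℝ) (x : E n) (c : ℝ) :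
    RCLike.re (𝓕⁻ (fun ξ : E n => ((exp (-(t * symbol s ξ)) : ℝ) : ℂ)) x * (c : ℂ))
      = kernel s t x * c :=
  Complex.re_mul_ofReal _ _

lemma integrable_kernel_sub_mul (hs0 : 0 < s) (hu₀ : Integrable u₀) (ht : 0 < t) (x : E n) :
    Integrable fun y => kernel s t (x - y) * u₀ y := by
  have hu : Integrable fun y => (u₀ y : ℂ) := hu₀.ofReal
  have hm : Integrable fun ξ : E n => ((exp (-(t * symbol s ξ)) : ℝ) : ℂ) :=
    (integrable_exp_neg_mul_symbol hs0 ht).ofReal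
  simpa only [re_fourierInv_mul_eq_kernel_mul] using (integrable_fourierInv_sub_mul hm hu x).re

lemma re_spectralSolution (hs0 : 0 < s) (hu₀ : Integrable u₀) (ht : 0 < t) (x : E n) :
    (spectralSolution s (fun y => (u₀ y : ℂ)) t x).re = ∫ y, kernel s t (x - y) * u₀ y := by
  have hu : Integrable fun y => (u₀ y : ℂ) := hu₀.ofReal
  have hm : Integrable fun ξ : E n => ((exp (-(t * symbol s ξ)) : ℝ) : ℂ) :=
    (integrable_exp_neg_mul_symbol hs0 ht).ofReal
  rw [spectralSolution, fourierInv_mul_fourier hm hu, ← RCLike.re_to_complex,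
    ← integral_re (integrable_fourierInv_sub_mul hm hu x)]
  simp only [re_fourierInv_mul_eq_kernel_mul]

end Kernel

namespace IsWeakSolution

variable {n : ℕ} {s : ℝ} {u₀ : E n → ℝ} {u : ℝ → E n → ℝ} {θ : ℝ → ℝ}

lemma integrable_prod (hu : IsWeakSolution s u₀ u) {T : ℝ} (hT : 0 < T) :
    Integrable (uncurry u) ((volume.restrict (Ioo 0 T)).prod volume) := by
  simpa only [IntegrableOn, Measure.volume_eq_prod, ← Measure.prod_restrict,
    Measure.restrict_univ] using hu.integrableOn T hT

lemma ae_integrable (hu : IsWeakSolution s u₀ u) : ∀ᵐ t : ℝ, 0 < t → Integrable (u t) := by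
  have hIoo (N : ℕ) : ∀ᵐ t : ℝ, t ∈ Ioo 0 (N + 1 : ℝ) → Integrable (u t) :=
    (ae_restrict_iff' measurableSet_Ioo).1 (hu.integrable_prod (by positivity)).prod_right_ae
  filter_upwards [ae_all_iff.2 hIoo] with t ht ht0
  obtain ⟨N, hN⟩ := exists_nat_gt t
  exact ht N ⟨ht0, by linarith⟩

lemma locallyIntegrableOn_fourierInv (hu : IsWeakSolution s u₀ u) (ξ : E n) :
    LocallyIntegrableOn (fun t => 𝓕⁻ (fun x => (u t x : ℂ)) ξ) (Ioi 0) := by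
  intro T (hT : 0 < T)
  refine ⟨Ioo 0 (T + 1), mem_nhdsWithin_of_mem_nhds (Ioo_mem_nhds hT (lt_add_one T)), ?_⟩
  have hwave := (contDiff_planeWave ξ).continuous
  have hint : Integrable (fun q : ℝ × E n => (u q.1 q.2 : ℂ) * planeWave ξ q.2)
      ((volume.restrict (Ioo 0 (T + 1))).prod volume) :=
    (hu.integrable_prod (by positivity)).ofReal.mul_bdd
      (hwave.comp continuous_snd).aestronglyMeasurable
      (.of_forall fun q => (norm_planeWave ξ q.2).le)
  simpa only [fourierInv_eq_integral_mul_planeWave] using! hint.integral_prod_left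

lemma weak_fourierInv (hu : IsWeakSolution s u₀ u) (hs0 : 0 < s) (hu₀ : Integrable u₀)
    (hθ : ContDiff ℝ ∞ θ) (hθc : HasCompactSupport θ) (ξ : E n) :
    (∫ t in Ioi 0, (deriv θ t - symbol s ξ * θ t) • 𝓕⁻ (fun x => (u t x : ℂ)) ξ)
      + θ 0 • 𝓕⁻ (fun x => (u₀ x : ℂ)) ξ = 0 := by
  have hwave := (contDiff_planeWave ξ).continuous
  have hle (x : E n) := (norm_planeWave ξ x).le
  have hint' := hu.integrable_mul_mul (hθ.continuous_deriv (by simp)) hθc.deriv hwave hle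
  have hint := (hu.integrable_mul_mul hθ.continuous hθc hwave hle).const_mul (symbol s ξ : ℂ)
  rw [← hu.weak_planeWave hs0 hu₀ hθ hθc ξ, pairing, pairing, ← integral_const_mul,
    ← integral_sub hint' hint]
  congr 1
  · refine Eq.trans ?_ (integral_spaceTime (hint'.sub hint)).symm
    congr 1; ext t
    rw [fourierInv_eq_integral_mul_planeWave, Complex.real_smul, ← integral_const_mul]
    congr 1; ext x
    simp only [Pi.sub_apply]
    push_cast
    ring
  · rw [fourierInv_eq_integral_mul_planeWave, Complex.real_smul]

lemma ae_fourierInv_eq (hu : IsWeakSolution s u₀ u) (hs0 : 0 < s) (hu₀ : Integrable u₀) (ξ : E n) :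
    ∀ᵐ t : ℝ, 0 < t → 𝓕⁻ (fun x => (u t x : ℂ)) ξ
      = exp (-(symbol s ξ * t)) • 𝓕⁻ (fun x => (u₀ x : ℂ)) ξ :=
  ae_eq_exp_smul_of_weak (hu.locallyIntegrableOn_fourierInv ξ)
    fun _ hθ hθc => hu.weak_fourierInv hs0 hu₀ hθ hθc ξ

lemma ae_fourier_eq (hu : IsWeakSolution s u₀ u) (hs0 : 0 < s) (hu₀ : Integrable u₀) :
    ∀ᵐ t : ℝ, 0 < t → 𝓕 (fun x => (u t x : ℂ))
      = fun ξ => ((exp (-(t * symbol s ξ)) : ℝ) : ℂ) * 𝓕 (fun y => (u₀ y : ℂ)) ξ := by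
  obtain ⟨D, hDc, hD⟩ := TopologicalSpace.exists_countable_dense (E n)
  have hmodes : ∀ᵐ t : ℝ, ∀ ξ ∈ D, 0 < t → 𝓕⁻ (fun x => (u t x : ℂ)) (-ξ)
      = exp (-(symbol s (-ξ) * t)) • 𝓕⁻ (fun x => (u₀ x : ℂ)) (-ξ) :=
    (ae_ball_iff hDc).2 fun ξ _ => hu.ae_fourierInv_eq hs0 hu₀ (-ξ)
  filter_upwards [hmodes, hu.ae_integrable] with t hmode hint ht
  have hsym := continuous_symbol (V := E n) hs0
  have hhat := continuous_fourier_of_integrable (hu₀.ofReal (𝕜 := ℂ))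
  refine Continuous.ext_on hD (continuous_fourier_of_integrable (hint ht).ofReal) (by fun_prop)
    fun ξ hξ => ?_
  simpa [fourierInv_eq_fourier_neg, symbol, mul_comm t] using hmode ξ hξ ht

lemma continuous_apply (hu : IsWeakSolution s u₀ u) {t : ℝ} (ht : 0 < t) : Continuous (u t) :=
  hu.continuousOn.comp_continuous (f := fun x : E n => (t, x)) (by fun_prop)
    fun x => ⟨ht, mem_univ x⟩

lemma ae_eq_spectralSolution (hu : IsWeakSolution s u₀ u) (hs0 : 0 < s) (hu₀ : Integrable u₀)
    (x : E n) :
    ∀ᵐ t : ℝ, 0 < t → (u t x : ℂ) = spectralSolution s (fun y => (u₀ y : ℂ)) t x := by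
  filter_upwards [hu.ae_fourier_eq hs0 hu₀, hu.ae_integrable] with t hfourier hint ht
  have hinv := (Complex.continuous_ofReal.comp (hu.continuous_apply ht)).fourierInv_fourier_eq
    (hint ht).ofReal
    ((integrable_exp_neg_mul_fourier hs0 hu₀.ofReal ht).congr (.of_eq (hfourier ht).symm))
  rw [spectralSolution, ← hfourier ht]
  exact (congrFun hinv x).symm

lemma eq_integral_kernel (hu : IsWeakSolution s u₀ u) (hs0 : 0 < s) (hu₀ : Integrable u₀) {t : ℝ}
    (ht : 0 < t) (x : E n) : u t x = ∫ y, kernel s t (x - y) * u₀ y := by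
  have hcont : ContinuousOn (fun t => u t x) (Ioi 0) :=
    hu.continuousOn.comp (f := fun t : ℝ => (t, x)) (by fun_prop) fun t ht => ⟨ht, mem_univ x⟩
  have heq : EqOn (fun t => (u t x : ℂ)) (fun t => spectralSolution s (fun y => (u₀ y : ℂ)) t x)
      (Ioi 0) :=
    Measure.eqOn_open_of_ae_eq
      ((ae_restrict_iff' measurableSet_Ioi).2 (hu.ae_eq_spectralSolution hs0 hu₀ x)) isOpen_Ioi
      (Complex.continuous_ofReal.comp_continuousOn hcont)
      (continuousOn_spectralSolution hs0 hu₀.ofReal x)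
  have hval : (u t x : ℂ) = spectralSolution s (fun y => (u₀ y : ℂ)) t x := heq ht
  rw [← re_spectralSolution hs0 hu₀ ht, ← hval, Complex.ofReal_re]

end IsWeakSolution

/-! ### Asymptotic expansion -/

section Remainder

variable {n : ℕ} {s t R : ℝ} {u₀ : E n → ℝ} {u : ℝ → E n → ℝ}

lemma clm_apply_eq_sum (L : E n →L[ℝ] ℝ) (y : E n) :
    L y = ∑ i, y i * L (EuclideanSpace.single i 1) := by
  conv_lhs => rw [← (EuclideanSpace.basisFun (Fin n) ℝ).sum_repr y]
  simp [map_sum]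

lemma integrable_apply_mul (hu₀ : Integrable u₀) (hR : ∀ᵐ y : E n, R < ‖y‖ → u₀ y = 0)
    (i : Fin n) : Integrable fun y : E n => y i * u₀ y := by
  refine (hu₀.norm.const_mul R).mono' ((Continuous.aestronglyMeasurable (by fun_prop)).mul
    hu₀.aestronglyMeasurable) ?_
  filter_upwards [hR] with y hy
  rw [norm_mul]
  by_cases hRy : R < ‖y‖
  · simp [hy hRy]
  · gcongr
    exact (PiLp.norm_apply_le y i).trans (not_lt.1 hRy)

lemma integral_fderiv_apply_mul (hu₀ : Integrable u₀) (hR : ∀ᵐ y : E n, R < ‖y‖ → u₀ y = 0)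
    (f : E n → ℝ) (x : E n) :
    Integrable (fun y => fderiv ℝ f x y * u₀ y) ∧
      ∫ y, fderiv ℝ f x y * u₀ y = ∑ i, firstMoment u₀ i * partialDeriv i f x := by
  have hint (i : Fin n) : Integrable fun y => y i * u₀ y * partialDeriv i f x :=
    (integrable_apply_mul hu₀ hR i).mul_const _
  have hsum (y : E n) : fderiv ℝ f x y * u₀ y = ∑ i, y i * u₀ y * partialDeriv i f x := by
    rw [clm_apply_eq_sum (fderiv ℝ f x) y, Finset.sum_mul]
    exact Finset.sum_congr rfl fun i _ => mul_right_comm _ _ _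
  simp only [hsum]
  refine ⟨integrable_finsetSum _ fun i _ => hint i, ?_⟩
  rw [integral_finsetSum _ fun i _ => hint i]
  simp only [integral_mul_const, firstMoment]

lemma remainder_eq_integral (hs0 : 0 < s) (hu₀ : Integrable u₀)
    (hR : ∀ᵐ y : E n, R < ‖y‖ → u₀ y = 0) (hu : IsWeakSolution s u₀ u) (ht : 0 < t) (x : E n) :
    remainder s u₀ u t x
      = ∫ y, (kernel s t (x - y) - kernel s t x + fderiv ℝ (kernel s t) x y) * u₀ y := by
  obtain ⟨hderiv, hderiv_eq⟩ := integral_fderiv_apply_mul hu₀ hR (kernel s t) x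
  have hconv := integrable_kernel_sub_mul hs0 hu₀ ht x
  have hconst : Integrable fun y => kernel s t x * u₀ y := hu₀.const_mul _
  have hdiff : Integrable fun y => kernel s t (x - y) * u₀ y - kernel s t x * u₀ y :=
    hconv.sub hconst
  simp only [add_mul, sub_mul]
  rw [integral_add hdiff hderiv, integral_sub hconv hconst, integral_const_mul,
    hderiv_eq, remainder, hu.eq_integral_kernel hs0 hu₀ ht x, mass, mul_comm (∫ y, u₀ y)]

lemma exists_abs_remainder_le (hs0 : 0 < s) (hs1 : s < 1) (hu₀ : Integrable u₀)
    (hR : ∀ᵐ y : E n, R < ‖y‖ → u₀ y = 0) (hu : IsWeakSolution s u₀ u) :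
    ∃ K : ℝ, ∀ t, 0 < t → R ≤ t ^ (1 / (2 * s)) → ∀ x,
      |remainder s u₀ u t x| ≤ K / (t ^ (1 / (2 * s))) ^ 2 * kernel s t x := by
  obtain ⟨C, hC, htaylor⟩ := exists_abs_kernel_taylor_le n hs0 hs1
  refine ⟨C * R ^ 2 * ∫ y, ‖u₀ y‖, fun t ht hRt x => ?_⟩
  have hkernel := kernel_pos hs0 hs1 ht x
  have hle : ∀ᵐ y, ‖(kernel s t (x - y) - kernel s t x + fderiv ℝ (kernel s t) x y) * u₀ y‖
      ≤ C * (R / t ^ (1 / (2 * s))) ^ 2 * kernel s t x * ‖u₀ y‖ := by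
    filter_upwards [hR] with y hy
    by_cases hRy : R < ‖y‖
    · simp [hy hRy]
    · have hyR := not_lt.1 hRy
      rw [norm_mul]
      gcongr
      refine (htaylor t ht x y (hyR.trans hRt)).trans ?_
      gcongr
  rw [remainder_eq_integral hs0 hu₀ hR hu ht, ← norm_eq_abs]
  refine (norm_integral_le_of_norm_le (hu₀.norm.const_mul _) hle).trans_eq ?_
  rw [integral_const_mul]
  ring

lemma eventually_abs_remainder_le (hs0 : 0 < s) (hs1 : s < 1) (hu₀ : Integrable u₀)
    (hR : ∀ᵐ y : E n, R < ‖y‖ → u₀ y = 0) (hu : IsWeakSolution s u₀ u) {ε : ℝ} (hε : 0 < ε) :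
    ∀ᶠ t in atTop, ∀ x,
      |remainder s u₀ u t x| ≤ ε * t ^ (-(1 / (2 * s))) * kernel s t x := by
  obtain ⟨K, hK⟩ := exists_abs_remainder_le hs0 hs1 hu₀ hR hu
  have hscale : Tendsto (fun t : ℝ => t ^ (1 / (2 * s))) atTop atTop :=
    tendsto_rpow_atTop (by positivity)
  filter_upwards [eventually_gt_atTop 0, hscale.eventually_ge_atTop R,
    (hscale.const_div_atTop K).eventually_le_const hε] with t ht hRt hε_le x
  have hkernel := kernel_pos hs0 hs1 ht x
  refine (hK t ht hRt x).trans ?_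
  rw [rpow_neg ht.le, ← div_eq_mul_inv, pow_two, ← div_div]
  gcongr

end Remainder

end FractionalHeat

end

theorem theorem4 (n : ℕ) (hn : 1 ≤ n) (s : ℝ) (hs0 : 0 < s) (hs1 : s < 1)
    (u₀ : FractionalHeat.E n → ℝ) (hu₀ : MeasureTheory.Integrable u₀)
    (hsupp : ∃ R : ℝ, ∀ᵐ y : FractionalHeat.E n, R < ‖y‖ → u₀ y = 0)
    (u : ℝ → FractionalHeat.E n → ℝ) (hu : FractionalHeat.IsWeakSolution s u₀ u) :
    TendstoUniformly
      (fun (t : ℝ) (x : FractionalHeat.E n) =>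
        t ^ (1 / (2 * s)) * (|FractionalHeat.remainder s u₀ u t x| / FractionalHeat.kernel s t x))
      (fun _ => 0) Filter.atTop ∧
    ∀ ε : ℝ, 0 < ε → ∀ᶠ t : ℝ in Filter.atTop, ∀ x : FractionalHeat.E n,
      |FractionalHeat.remainder s u₀ u t x|
        ≤ ε * t ^ (-(1 / (2 * s))) * FractionalHeat.kernel s t x := by
  obtain ⟨R, hR⟩ := hsupp
  have hrem {ε : ℝ} (hε : 0 < ε) :=
    FractionalHeat.eventually_abs_remainder_le hs0 hs1 hu₀ hR hu hε
  refine ⟨Metric.tendstoUniformly_iff.2 fun ε hε => ?_, fun ε hε => hrem hε⟩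
  filter_upwards [hrem (half_pos hε), Filter.eventually_gt_atTop 0] with t hle ht x
  have hkernel := FractionalHeat.kernel_pos hs0 hs1 ht x
  rw [dist_zero_left, Real.norm_of_nonneg (by positivity)]
  calc
    _ ≤ t ^ (1 / (2 * s)) * (ε / 2 * t ^ (-(1 / (2 * s)))) := by
      gcongr
      exact (div_le_iff₀ hkernel).2 (hle x)
    _ = ε / 2 := by
      rw [Real.rpow_neg ht.le]
      field_simp
    _ < ε := half_lt_self hε
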